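/- Let $\psi_i,\psi^\dagger_i$ $(i\in\mathbb Z)$ be charged free fermions, $[\psi_i,\psi^\dagger_j]_+=\delta_{ij}$, $[\psi_i,\psi_j]_+=[\psi_i^\dagger,\psi_j^\dagger]_+=0$, acting on the fermionic Fock space (completed, so that arbitrary formal sums of basis vectors are allowed) with vacuum $|0\rangle$, $\psi_{-i-1}|0\rangle=\psi^\dagger_i|0\rangle=0$ for $i\ge 0$, and let $:\psi_i\psi_j^\dagger:\;=\psi_i\psi_j^\dagger-\langle 0|\psi_i\psi_j^\dagger|0\rangle$. For a partition $\lambda$ let $|\lambda\rangle=\psi_{x_1}\psi_{x_2}\psi_{x_3}\cdots$ be the basis vector in which exactly the sites $x_i=\lambda_i-i$, $i=1,2,3,\dots$, are occupied. Let $p\ge 1$ be an integer, $r:\mathbb Z\to\mathbb C$ any function, $\mathbf p=(p_1,p_2,\dots)$ complex parameters, and $$A_{np}(r)=\sum_{i\in\mathbb Z}r(i)\,r(i-p)\cdots r(i-p(n-1)):\psi_i\psi^\dagger_{i-pn}:,\qquad \Gamma_{p;r}(\mathbf p)=\exp\sum_{n>0}\frac1n\,p_nA_{np}(r).$$ For $c=0,\dots,p-1$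 put $\psi^{(c)}_i=\psi_{pi+c}$, $\psi^{\dagger(c)}_i=\psi^\dagger_{pi+c}$, $r^{(c)}(i)=r(pi+c)$, and $$\Gamma^{(c)}_{1;r^{(c)}}(\mathbf p)=\exp\sum_{n>0}\frac1n\,p_n\sum_{i\in\mathbb Z}r^{(c)}(i)\cdots r^{(c)}(i-n+1):\psi^{(c)}_i\psi^{\dagger(c)}_{i-n}:.$$ Then the operators $\Gamma^{(c)}_{1;r^{(c)}}(\mathbf p)$ commute with each other and $$\Gamma_{p;r}(\mathbf p)=\prod_{c=0}^{p-1}\Gamma^{(c)}_{1;r^{(c)}}(\mathbf p).$$ Moreover, for all partitions $\lambda,\mu$, $$\langle\lambda|\Gamma_{p;r}(\mathbf p)|\mu\rangle=r_{\lambda/\mu}\,s_{\lambda/\mu}(\tilde{\mathbf p})=\varepsilon_p(\lambda,\mu)\prod_{c=0}^{p-1}r^{(c)}_{\lambda^{(c)}/\mu^{(c)}}\,s_{\lambda^{(c)}/\mu^{(c)}}(\mathbf p),$$ with the following notation. * $\lambda^{(c)}$ is the weakly decreasing, eventually constant integer sequence with $\lambda^{(c)}_i-i=x^{(c)}_i$,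 where $x^{(c)}_1>x^{(c)}_2>\cdots$ are all the integers $x$ such that $px+c\in\{x_1,x_2,\dots\}$. Its eventual value is the charge of colour $c$; it is a partition when the charge is $0$. * $s_{\alpha/\beta}(\mathbf p)=\det\big(h_{\alpha_i-\beta_j-i+j}(\mathbf p)\big)_{1\le i,j\le N}$, where $\sum_k h_k(\mathbf p)z^k=\exp\sum_{m>0}\frac1m p_mz^m$, $h_k=0$ for $k<0$, and $\alpha_i=\beta_i$ for $i>N$; $s_{\alpha/\beta}=0$ if $\alpha$ and $\beta$ have different eventual values. * $\tilde p_{pn}=p\cdot p_n$ for $n\ge1$, and $\tilde p_m=0$ if $p\nmid m$; that is, $\sum_m\frac1m\tilde p_mz^m=\sum_n\frac1np_nz^{pn}$. * $r^{(c)}_{\alpha/\beta}=\prod_{(i,j)}r^{(c)}(j-i)$ over the boxes $(i,j)$ of $\alpha/\beta$, that is, $i\ge1$, $\beta_i<j\le\alpha_i$; and $r_{\lambda/\mu}=\prod_{c=0}^{p-1}\prod_{(i,j)\in\lambda^{(c)}/\mu^{(c)}}r(pj-pi+c)$, which for $p=1$ is the usual content product of $\lambda/\mu$. (Where such a product is infinite,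 the accompanying $s$-factor vanishes and the expression is read as $0$.) * $\varepsilon_p(\lambda,\mu)=(-1)^{\mathrm{inv}_N(\lambda)+\mathrm{inv}_N(\mu)}$ with $N=\max(\ell(\lambda),\ell(\mu))$ and $\mathrm{inv}_N(\lambda)=\#\{1\le i<j\le N:\ (x_i\bmod p)>(x_j\bmod p)\}$; it is the relative sign of reordering the fermions of $|\lambda\rangle$ and $|\mu\rangle$ by colour, and $\varepsilon_1=1$. -/

import Mathlib

noncomputable section

namespace FermionFlow

/-! ## Charged free fermions on the (completed) Fock space -/

/-- A Maya diagram: a set of occupied sites of `ℤ` containing almost all negative integers and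
only finitely many nonnegative ones. Maya diagrams label the basis vectors of Fock space. -/
@[ext]
structure Maya where
  occ : Set ℤ
  particles_finite : {i | i ∈ occ ∧ 0 ≤ i}.Finite
  holes_finite : {i | i ∉ occ ∧ i < 0}.Finite

namespace Maya

/-- Fill the site `i`. -/
def fill (S : Maya) (i : ℤ) : Maya where
  occ := insert i S.occ
  particles_finite := (S.particles_finite.insert i).subset (by
    rintro x ⟨hx | hx, h0⟩
    · exact Or.inl hx
    · exact Or.inr ⟨hx, h0⟩)
  holes_finite := S.holes_finite.subset (by
    rintro x ⟨hx, h0⟩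
    exact ⟨fun h => hx (Or.inr h), h0⟩)

/-- Empty the site `i`. -/
def clear (S : Maya) (i : ℤ) : Maya where
  occ := S.occ \ {i}
  particles_finite := S.particles_finite.subset (by
    rintro x ⟨hx, h0⟩
    exact ⟨hx.1, h0⟩)
  holes_finite := (S.holes_finite.insert i).subset (by
    rintro x ⟨hx, h0⟩
    by_cases hxi : x = i
    · exact Or.inl hxi
    · exact Or.inr ⟨fun h => hx ⟨h, hxi⟩, h0⟩)

/-- The Dirac sea: exactly the negative sites are occupied. -/
def vacuum : Maya where
  occ := {i | i < 0}
  particles_finite := Set.finite_empty.subset (by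
    rintro x ⟨hx, h0⟩
    exact absurd hx (not_lt.mpr h0))
  holes_finite := Set.finite_empty.subset (by
    rintro x ⟨hx, h0⟩
    exact absurd h0 hx)

/-- The fermionic sign `(-1)^(number of occupied sites above i)`. -/
def sgn (S : Maya) (i : ℤ) : ℂ := (-1) ^ {s | s ∈ S.occ ∧ i < s}.ncard

/-- The energy of a Maya diagram: the sum of the particle positions minus the sum of the hole
positions. -/
def energy (S : Maya) : ℤ :=
  ∑ i ∈ S.particles_finite.toFinset, i - ∑ i ∈ S.holes_finite.toFinset, i

theorem energy_nonneg (S : Maya) : 0 ≤ S.energy := by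
  have h1 : 0 ≤ ∑ i ∈ S.particles_finite.toFinset, i :=
    Finset.sum_nonneg fun i hi => by simp at hi; exact hi.2
  have h2 : ∑ i ∈ S.holes_finite.toFinset, i ≤ 0 :=
    Finset.sum_nonpos fun i hi => by simp at hi; exact hi.2.le
  unfold energy
  linarith

theorem energy_fill (S : Maya) {i : ℤ} (hi : i ∉ S.occ) : (S.fill i).energy = S.energy + i := by
  classical
  unfold energy
  rcases lt_or_ge i 0 with h | h
  · have e1 : (S.fill i).particles_finite.toFinset = S.particles_finite.toFinset := by
      ext x
      simp only [fill, Set.Finite.mem_toFinset, Set.mem_ofPred_eq, Set.mem_insert_iff]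
      constructor
      · rintro ⟨rfl | hx, h0⟩
        · omega
        · exact ⟨hx, h0⟩
      · rintro ⟨hx, h0⟩
        exact ⟨Or.inr hx, h0⟩
    have e2 : S.holes_finite.toFinset = insert i (S.fill i).holes_finite.toFinset := by
      ext x
      simp only [fill, Set.Finite.mem_toFinset, Set.mem_ofPred_eq, Set.mem_insert_iff,
        Finset.mem_insert]
      constructor
      · rintro ⟨hx, h0⟩
        by_cases hxi : x = i
        · exact Or.inl hxi
        · exact Or.inr ⟨by tauto, h0⟩
      · rintro (rfl | ⟨hx, h0⟩)
        · exact ⟨hi, h⟩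
        · exact ⟨by tauto, h0⟩
    rw [e1, e2, Finset.sum_insert (by simp [fill])]
    ring
  · have e1 : (S.fill i).particles_finite.toFinset = insert i S.particles_finite.toFinset := by
      ext x
      simp only [fill, Set.Finite.mem_toFinset, Set.mem_ofPred_eq, Set.mem_insert_iff,
        Finset.mem_insert]
      constructor
      · rintro ⟨hx | hx, h0⟩
        · exact Or.inl hx
        · exact Or.inr ⟨hx, h0⟩
      · rintro (rfl | ⟨hx, h0⟩)
        · exact ⟨Or.inl rfl, h⟩
        · exact ⟨Or.inr hx, h0⟩
    have e2 : (S.fill i).holes_finite.toFinset = S.holes_finite.toFinset := by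
      ext x
      simp only [fill, Set.Finite.mem_toFinset, Set.mem_ofPred_eq, Set.mem_insert_iff]
      constructor
      · rintro ⟨hx, h0⟩
        exact ⟨by tauto, h0⟩
      · rintro ⟨hx, h0⟩
        refine ⟨?_, h0⟩
        rintro (rfl | h')
        · omega
        · exact hx h'
    rw [e1, e2, Finset.sum_insert (by simp [hi])]
    ring

theorem energy_clear (S : Maya) {i : ℤ} (hi : i ∈ S.occ) :
    (S.clear i).energy = S.energy - i := by
  have h : (S.clear i).fill i = S := by
    ext x
    simp only [fill, clear, Set.mem_insert_iff, Set.mem_sdiff, Set.mem_singleton_iff]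
    constructor
    · rintro (rfl | h)
      · exact hi
      · exact h.1
    · intro h
      by_cases hx : x = i
      · exact Or.inl hx
      · exact Or.inr ⟨h, hx⟩
  have h2 := energy_fill (S.clear i) (i := i) (by simp [clear])
  rw [h] at h2
  linarith

end Maya

/-- The completed Fock space: arbitrary formal sums `∑_S v(S) |S⟩` over Maya diagrams. -/
abbrev Fock := Maya → ℂ

open Classical in
/-- The basis vector `|S⟩`. -/
def ket (S : Maya) : Fock := Pi.single S 1

/-- The matrix element `⟨S| X |S'⟩`. -/
def matrixElement (S : Maya) (X : Module.End ℂ Fock) (S' : Maya) : ℂ := X (ket S') S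

open Classical in
/-- The creation operator `ψ_i`: `ψ_i |S⟩ = (-1)^#{s ∈ S, s > i} |S ∪ {i}⟩` if `i ∉ S`, and
`ψ_i |S⟩ = 0` otherwise. -/
def psi (i : ℤ) : Module.End ℂ Fock where
  toFun v S := if i ∈ S.occ then S.sgn i * v (S.clear i) else 0
  map_add' v w := by
    funext S
    by_cases h : i ∈ S.occ <;> simp [h, mul_add]
  map_smul' a v := by
    funext S
    by_cases h : i ∈ S.occ <;> simp [h, mul_left_comm]

open Classical in
/-- The annihilation operator `ψ†_i`: `ψ†_i |S⟩ = (-1)^#{s ∈ S, s > i} |S \ {i}⟩` if `i ∈ S`, and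
`ψ†_i |S⟩ = 0` otherwise. -/
def psiDag (i : ℤ) : Module.End ℂ Fock where
  toFun v S := if i ∈ S.occ then 0 else S.sgn i * v (S.fill i)
  map_add' v w := by
    funext S
    by_cases h : i ∈ S.occ <;> simp [h, mul_add]
  map_smul' a v := by
    funext S
    by_cases h : i ∈ S.occ <;> simp [h, mul_left_comm]

/-- The normally ordered bilinear `:ψ_i ψ†_j: = ψ_i ψ†_j - ⟨0|ψ_i ψ†_j|0⟩`. -/
def bilinear (i j : ℤ) : Module.End ℂ Fock :=
  psi i * psiDag j - matrixElement Maya.vacuum (psi i * psiDag j) Maya.vacuum • 1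

/-! ## Infinite sums and exponentials of operators -/

/-- A family of operators is locally finite if, for each `S`, only finitely many members of it
have a nonzero `S`-row. -/
def LocallyFinite {ι : Type*} (T : ι → Module.End ℂ Fock) : Prop :=
  ∀ S : Maya, {a | ∃ v, T a v S ≠ 0}.Finite

/-- The sum of a locally finite family of operators. -/
def opSum {ι : Type*} (T : ι → Module.End ℂ Fock) (hT : LocallyFinite T) :
    Module.End ℂ Fock where
  toFun v S := ∑ a ∈ (hT S).toFinset, T a v S
  map_add' v w := by
    funext S
    simp [Finset.sum_add_distrib]
  map_smul' a v := by
    funext S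
    simp [Finset.mul_sum]

/-- `T` strictly raises the energy: the `S`-coordinate of `T v` depends only on the coordinates
of `v` of smaller energy. -/
def Raises (T : Module.End ℂ Fock) : Prop :=
  ∀ (v : Fock) (S : Maya), (∀ S' : Maya, S'.energy < S.energy → v S' = 0) → T v S = 0

theorem Raises.pow_apply {T : Module.End ℂ Fock} (hT : Raises T) (k : ℕ) :
    ∀ (v : Fock) (S : Maya), S.energy < k → (T ^ k) v S = 0 := by
  induction k with
  | zero =>
    intro v S h
    exact absurd h (not_lt.mpr (by simpa using S.energy_nonneg))
  | succ k ih =>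
    intro v S h
    rw [pow_succ', Module.End.mul_apply]
    refine hT _ S fun S' h' => ih v S' ?_
    push_cast at h
    omega

theorem Raises.locallyFinite_exp {T : Module.End ℂ Fock} (hT : Raises T) :
    LocallyFinite fun k : ℕ => ((k.factorial : ℂ)⁻¹) • T ^ k := by
  intro S
  refine (Set.finite_le_nat S.energy.toNat).subset ?_
  rintro k ⟨v, hv⟩
  by_contra hk
  have hk' : S.energy < k := by
    simp only [Set.mem_ofPred_eq, not_le] at hk
    omega
  exact hv (by simp [hT.pow_apply k v S hk'])

/-- The exponential `∑_k T^k / k!` of an operator that strictly raises the energy. -/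
def opExp (T : Module.End ℂ Fock) (hT : Raises T) : Module.End ℂ Fock :=
  opSum (fun k : ℕ => ((k.factorial : ℂ)⁻¹) • T ^ k) hT.locallyFinite_exp

theorem Raises.smul {T : Module.End ℂ Fock} (hT : Raises T) (a : ℂ) : Raises (a • T) := by
  intro v S h
  simp [hT v S h]

theorem raises_opSum {ι : Type*} {T : ι → Module.End ℂ Fock} (hT : LocallyFinite T)
    (h : ∀ a, Raises (T a)) : Raises (opSum T hT) := by
  intro v S hS
  exact Finset.sum_eq_zero fun a _ => h a v S hS

theorem bilinear_of_ne {i j : ℤ} (hij : i ≠ j) : bilinear i j = psi i * psiDag j := by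
  have h : matrixElement Maya.vacuum (psi i * psiDag j) Maya.vacuum = 0 := by
    simp only [matrixElement, Module.End.mul_apply, psi, psiDag, LinearMap.coe_mk, AddHom.coe_mk]
    split_ifs with h1 h2
    · simp
    · have hne : (Maya.vacuum.clear i).fill j ≠ Maya.vacuum := by
        intro he
        have : i ∈ ((Maya.vacuum.clear i).fill j).occ := by rw [he]; exact h1
        simp [Maya.fill, Maya.clear, hij] at this
      simp [ket, hne]
    · rfl
  simp [bilinear, h]

theorem bilinear_apply_ne_zero {i j : ℤ} (hij : i ≠ j) {v : Fock} {S : Maya}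
    (h : bilinear i j v S ≠ 0) : i ∈ S.occ ∧ j ∉ S.occ := by
  rw [bilinear_of_ne hij] at h
  simp only [Module.End.mul_apply, psi, psiDag, LinearMap.coe_mk, AddHom.coe_mk] at h
  split_ifs at h with h1 h2
  · simp at h
  · refine ⟨h1, fun hj => h2 ⟨hj, fun h' => hij h'.symm⟩⟩
  · simp at h

theorem raises_bilinear {i j : ℤ} (hij : j < i) : Raises (bilinear i j) := by
  intro v S hS
  rw [bilinear_of_ne hij.ne']
  simp only [Module.End.mul_apply, psi, psiDag, LinearMap.coe_mk, AddHom.coe_mk]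
  split_ifs with h1 h2
  · simp
  · rw [hS]
    · simp
    · rw [Maya.energy_fill _ h2, Maya.energy_clear _ h1]
      omega
  · rfl

/-! ## The abelian flows

The fermions of a flow are `ψ_{e i}, ψ†_{e i}`, `i ∈ ℤ`, for a strictly increasing `e : ℤ → ℤ`:
the identity for the one-component fermions and `i ↦ p i + c` for the fermions of colour `c`. -/

theorem locallyFinite_current (e : ℤ ↪o ℤ) (a : ℤ → ℂ) {d : ℤ} (hd : 0 < d) :
    LocallyFinite fun i : ℤ => a i • bilinear (e i) (e (i - d)) := by
  intro S
  have key : ∀ i, (∃ v, (a i • bilinear (e i) (e (i - d))) v S ≠ 0) →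
      e i ∈ S.occ ∧ e (i - d) ∉ S.occ := by
    rintro i ⟨v, hv⟩
    refine bilinear_apply_ne_zero (v := v) ?_ ?_
    · intro h
      have := e.injective h
      omega
    · intro h
      exact hv (by simp [h])
  have f1 : {i | e i ∈ S.occ ∧ 0 ≤ e i}.Finite :=
    S.particles_finite.preimage e.injective.injOn
  have f2 : {i | e (i - d) ∉ S.occ ∧ e (i - d) < 0}.Finite :=
    S.holes_finite.preimage (f := fun i => e (i - d)) (fun x _ y _ h => by
      have := e.injective h
      omega)
  refine (f1.union f2).subset fun i hi => ?_
  obtain ⟨h1, h2⟩ := key i hi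
  rcases lt_or_ge (e i) 0 with h | h
  · exact Or.inr ⟨h2, lt_trans (e.strictMono (by omega)) h⟩
  · exact Or.inl ⟨h1, h⟩

theorem step_pos (q n : ℕ+) : (0 : ℤ) < ((q : ℕ) : ℤ) * ((n : ℕ) : ℤ) := by
  have := q.pos
  have := n.pos
  positivity

/-- `∑_{i ∈ ℤ} r(i) r(i - q) ⋯ r(i - q (n - 1)) :ψ_{e i} ψ†_{e (i - q n)}:`. -/
def current (e : ℤ ↪o ℤ) (q : ℕ+) (r : ℤ → ℂ) (n : ℕ+) : Module.End ℂ Fock :=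
  opSum (fun i : ℤ => (∏ k ∈ Finset.range n, r (i - ((q : ℕ) : ℤ) * k)) •
      bilinear (e i) (e (i - ((q : ℕ) : ℤ) * ((n : ℕ) : ℤ))))
    (locallyFinite_current e _ (step_pos q n))

theorem raises_current (e : ℤ ↪o ℤ) (q : ℕ+) (r : ℤ → ℂ) (n : ℕ+) :
    Raises (current e q r n) :=
  raises_opSum _ fun i => (raises_bilinear (e.strictMono (by
    have := step_pos q n
    omega))).smul _

theorem le_sub_of_orderEmbedding (e : ℤ ↪o ℤ) (x : ℤ) (d : ℕ) : (d : ℤ) ≤ e x - e (x - d) := by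
  induction d with
  | zero => simp
  | succ d ih =>
    have h : e (x - ((d + 1 : ℕ) : ℤ)) < e (x - d) := e.strictMono (by push_cast; omega)
    push_cast at h ⊢
    omega

theorem locallyFinite_generator (e : ℤ ↪o ℤ) (q : ℕ+) (r : ℤ → ℂ) (t : ℕ → ℂ) :
    LocallyFinite fun n : ℕ+ => (t n / (n : ℕ)) • current e q r n := by
  intro S
  refine ((Set.finite_le_nat S.energy.toNat).preimage
    (f := fun n : ℕ+ => (n : ℕ)) PNat.coe_injective.injOn).subset ?_
  rintro n ⟨v, hv⟩
  have hv' : current e q r n v S ≠ 0 := fun h => hv (by simp [h])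
  obtain ⟨i, -, hi⟩ := Finset.exists_ne_zero_of_sum_ne_zero hv'
  set d : ℤ := ((q : ℕ) : ℤ) * ((n : ℕ) : ℤ) with hd
  have hd0 : 0 < d := step_pos q n
  have hne : e i ≠ e (i - d) := (e.strictMono (by omega)).ne'
  obtain ⟨h1, h2⟩ := bilinear_apply_ne_zero hne (v := v) (S := S) (fun h => hi (by simp [h]))
  have h3 := ((S.clear (e i)).fill (e (i - d))).energy_nonneg
  rw [Maya.energy_fill _ (show e (i - d) ∉ S.occ \ {e i} from fun h => h2 h.1), Maya.energy_clear _ h1] at h3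
  have h4 := le_sub_of_orderEmbedding e i d.toNat
  rw [Int.toNat_of_nonneg hd0.le] at h4
  have h5 : ((n : ℕ) : ℤ) ≤ d := by
    have := q.pos
    have := n.pos
    nlinarith
  simp only [Set.mem_preimage, Set.mem_ofPred_eq]
  omega

/-- `exp ∑_{n > 0} (1/n) t_n A_n`, where `A_n` is `current e q r n`. -/
def flow (e : ℤ ↪o ℤ) (q : ℕ+) (r : ℤ → ℂ) (t : ℕ → ℂ) : Module.End ℂ Fock :=
  opExp (opSum (fun n : ℕ+ => (t n / (n : ℕ)) • current e q r n)
      (locallyFinite_generator e q r t))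
    (raises_opSum _ fun n => (raises_current e q r n).smul _)

/-- `Γ_{p;r}(t) = exp ∑_{n > 0} (1/n) t_n A_{np}(r)`, with
`A_{np}(r) = ∑_i r(i) r(i - p) ⋯ r(i - p (n - 1)) :ψ_i ψ†_{i - p n}:`. -/
def Gam (p : ℕ+) (r : ℤ → ℂ) (t : ℕ → ℂ) : Module.End ℂ Fock :=
  flow (RelEmbedding.refl _) p r t

/-- The site `p i + c`, so that `ψ^{(c)}_i = ψ_{p i + c}`. -/
def colourSite (p : ℕ+) (c : ℤ) : ℤ ↪o ℤ :=
  OrderEmbedding.ofStrictMono (fun i => ((p : ℕ) : ℤ) * i + c) (fun x y h => by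
    have hp : (0 : ℤ) < ((p : ℕ) : ℤ) := by exact_mod_cast p.pos
    have := mul_lt_mul_of_pos_left h hp
    simpa using this)

/-- The one-component flow of the fermions of colour `c`: `Γ^{(c)}_{1;r}(t) =
exp ∑_{n > 0} (1/n) t_n ∑_i r(i) r(i - 1) ⋯ r(i - n + 1) :ψ^{(c)}_i ψ^{†(c)}_{i - n}:`. -/
def colourGam (p : ℕ+) (c : ℤ) (r : ℤ → ℂ) (t : ℕ → ℂ) : Module.End ℂ Fock :=
  flow (colourSite p c) 1 r t

/-- `r^{(c)}(i) = r(p i + c)`. -/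
def colourFun (p : ℕ+) (c : ℤ) (r : ℤ → ℂ) (i : ℤ) : ℂ := r (((p : ℕ) : ℤ) * i + c)

/-! ## Partitions, their Maya diagrams and their colour components

Rows are numbered from `0` here, so row `i` below is row `i + 1` in the usual numbering. -/

/-- The particle coordinates `λ_i - i` (`i = 1, 2, …`) of a partition. -/
def coord (la : YoungDiagram) (i : ℕ) : ℤ := (la.rowLen i : ℤ) - ((i : ℤ) + 1)

theorem coord_strictAnti (la : YoungDiagram) : StrictAnti (coord la) := by
  intro i j h
  have := la.rowLen_anti i j h.le
  unfold coord
  omega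

theorem coord_of_le (la : YoungDiagram) {i : ℕ} (h : la.colLen 0 ≤ i) :
    coord la i = -((i : ℤ) + 1) := by
  have : la.rowLen i = 0 := by
    by_contra hne
    have h1 : (i, 0) ∈ la := YoungDiagram.mem_iff_lt_rowLen.mpr (Nat.pos_of_ne_zero hne)
    have h2 := YoungDiagram.mem_iff_lt_colLen.mp h1
    omega
  simp [coord, this]

/-- The Maya diagram `{λ_i - i : i = 1, 2, …}` of the partition `λ`; the basis vector `|λ⟩` is
`ket (mayaOf λ)`. -/
def mayaOf (la : YoungDiagram) : Maya where
  occ := Set.range (coord la)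
  particles_finite := ((Set.finite_lt_nat (la.colLen 0)).image (coord la)).subset (by
    rintro _ ⟨⟨i, rfl⟩, h0⟩
    refine ⟨i, ?_, rfl⟩
    by_contra h
    rw [coord_of_le la (not_lt.mp h)] at h0
    omega)
  holes_finite := (Set.finite_Icc (-(la.colLen 0 : ℤ)) 0).subset (by
    rintro x ⟨hx, h0⟩
    refine ⟨?_, h0.le⟩
    by_contra h
    refine hx ⟨(-x - 1).toNat, ?_⟩
    rw [coord_of_le la (by omega)]
    omega)

/-- The elements of a set of integers that is bounded above and not below, in decreasing order. -/
def enumDown (X : Set ℤ) : ℕ → ℤ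
  | 0 => sSup X
  | i + 1 => sSup {x | x ∈ X ∧ x < enumDown X i}

/-- The row lengths of the partition `λ`, as integers. -/
def rows (la : YoungDiagram) (i : ℕ) : ℤ := la.rowLen i

/-- The rows `λ^{(c)}_i` of the component of colour `c`: if `x^{(c)}_1 > x^{(c)}_2 > ⋯` are all the
`x` with `p x + c` an occupied site of `|λ⟩`, then `x^{(c)}_i = λ^{(c)}_i - i`. This is a weakly
decreasing sequence of integers which is eventually constant; it is a partition if the constant
(the charge of the colour `c`) is zero. -/
def colourRows (p : ℕ+) (c : ℤ) (la : YoungDiagram) (i : ℕ) : ℤ :=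
  enumDown {x | ((p : ℕ) : ℤ) * x + c ∈ (mayaOf la).occ} i + ((i : ℤ) + 1)

/-- The number of pairs among the particles `1, …, N` of `λ` whose colours decrease from the
upper particle to the lower one. -/
def colourInversions (p : ℕ+) (la : YoungDiagram) (N : ℕ) : ℕ :=
  {ij ∈ Finset.range N ×ˢ Finset.range N | ij.1 < ij.2 ∧
    coord la ij.2 % ((p : ℕ) : ℤ) < coord la ij.1 % ((p : ℕ) : ℤ)}.card

/-- The `p`-sign of `λ/μ`: the relative sign of reordering the particles of `|λ⟩` and of `|μ⟩` by
colour. -/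
def colourSign (p : ℕ+) (la mu : YoungDiagram) : ℂ :=
  (-1) ^ (colourInversions p la (max (la.colLen 0) (mu.colLen 0)) +
    colourInversions p mu (max (la.colLen 0) (mu.colLen 0)))

/-! ## Content products and skew Schur functions -/

/-- `h_k(t)`, given by `∑_k h_k(t) z^k = exp ∑_{m > 0} (1/m) t_m z^m`, and zero for `k < 0`. The
value `t 0` is not used (the coefficient of `z^0` in the exponent is `t 0 / 0 = 0`). -/
def complete (t : ℕ → ℂ) (k : ℤ) : ℂ :=
  if k < 0 then 0 else
    PowerSeries.coeff k.toNat
      ((PowerSeries.exp ℂ).subst (PowerSeries.mk fun m : ℕ => t m / (m : ℂ)))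

open Classical in
/-- The skew Schur function `s_{a/b}(t) = det (h_{a_i - b_j - i + j}(t))` in the power sum
variables `t`, for weakly decreasing integer sequences `a`, `b` which agree from some row on
(for partitions: always); it vanishes unless `b ≤ a`. If `a`, `b` have different limits, it is
set to zero. -/
def skewSchur (t : ℕ → ℂ) (a b : ℕ → ℤ) : ℂ :=
  if h : ∃ N : ℕ, ∀ i, N ≤ i → a i = b i then
    Matrix.det (Matrix.of fun i j : Fin (Nat.find h) =>
      complete t (a i - b j - (i : ℕ) + (j : ℕ)))
  else 0

/-- The content product `∏ r(j - i)` over the boxes `(i, j)`, `b_i < j ≤ a_i`, of `a/b`. -/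
def contentProd (r : ℤ → ℂ) (a b : ℕ → ℤ) : ℂ :=
  ∏ᶠ i : ℕ, ∏ j ∈ Finset.Ioc (b i) (a i), r (j - ((i : ℤ) + 1))

/-- `r_{λ/μ}` for the step `p`: the product of `r(p j - p i + c)` over the boxes `(i, j)` of
`λ^{(c)}/μ^{(c)}` and over `c = 0, …, p - 1`. For `p = 1` it is the content product of `λ/μ`. -/
def stepContentProd (p : ℕ+) (r : ℤ → ℂ) (la mu : YoungDiagram) : ℂ :=
  ∏ c ∈ Finset.range p, ∏ᶠ i : ℕ, ∏ j ∈ Finset.Ioc (colourRows p c mu i) (colourRows p c la i),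
    r (((p : ℕ) : ℤ) * j - ((p : ℕ) : ℤ) * ((i : ℤ) + 1) + c)

/-- The stretched times `u`: `u_{p n} = p t_n`, and `u_m = 0` if `p` does not divide `m`. Thus
`∑_m (1/m) u_m z^m = ∑_n (1/n) t_n z^{p n}`. -/
def stretch (p : ℕ+) (t : ℕ → ℂ) (m : ℕ) : ℂ :=
  if (p : ℕ) ∣ m then (p : ℕ) * t (m / p) else 0

end FermionFlow

end

/-!
The flow `Γ = Gam p r t` is the exponential of `T = ∑_n (1/n) t_n A_{np}(r)`, an operator quadratic
in the fermions that only moves particles up by multiples of `p`; both halves of the theorem are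
consequences of this.

*Factorization.* A quadratic operator that moves particles within one residue class modulo `p`
commutes with one that acts on another class (`commute_bilinear`), and `T` is the sum of its
restrictions `T_c` to the residue classes (`generator_eq_sum`). Hence the `T_c` commute and
`exp ∑_c T_c = ∏_c exp T_c` (`opExp_sum`). The infinite sums are handled by giving Fock space the
product topology: a locally finite sum of operators is then a convergent series (`hasSum_opSum`),
the operators in question are continuous, and a continuous operator that commutes with all terms of
such a sum commutes with the sum (`commute_opSum`).

*Matrix elements.* On one-particle states `A_{np}(r)` is the `n`-th power of the weighted shift
`A_p(r)`, so that `[T, ·]` acts on the fields `∑_k F_k r(y + p) ⋯ r(y + k p) ψ_{y + k p}` as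
multiplication of `∑_k F_k z^k` by `∑_m (1/m) t_m z^m`. Exponentiating gives
`Γ ψ_y = (∑_i K(i, y) ψ_i) Γ` with `K(y + p k, y) = h_k(t) r(y + p) ⋯ r(y + k p)` (`Gam_mul_psi`).
Applied to the topmost particle of `|μ⟩` this is a Laplace expansion, and by induction
`⟨λ| Γ |μ⟩ = det K(λ_i - i, μ_j - j)` (`matrixElement_sea`, `matrixElement_Gam`).

*Splitting by colour.* The kernel `K` vanishes between different residue classes, as does
`h_{x - y}` at the stretched times. Sorting rows and columns by colour makes either determinant
block diagonal, at the cost of the sign of the two sorting permutations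
(`det_eq_sign_mul_prod_det`, `sign_sort`); if the numbers of particles of some colour differ, both
sides are zero. In the block of colour `c` the entries are
`h_{x - y}(t) ∏_{y < m ≤ x} r^{(c)}(m)`, and the products of `r^{(c)}` give the same factor in every
nonzero term of the determinant, because the intervals `(y_j, x_{σ j}]` cover each site as often as
the intervals `(y_j, x_j]` (`prod_Ioc_perm`). This factor is the content product, also when `r` has
zeros.
-/

namespace FermionFlow

open PowerSeries
open Finset.HasAntidiagonal (antidiagonal mem_antidiagonal)

/-! ### Locally finite sums of operators as convergent series -/

theorem hasSum_opSum {ι : Type*} {T : ι → Module.End ℂ Fock} (hT : LocallyFinite T) (v : Fock) :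
    HasSum (fun a => T a v) (opSum T hT v) := by
  rw [Pi.hasSum]
  intro S
  refine hasSum_sum_of_ne_finset_zero fun a ha => ?_
  by_contra h
  exact ha ((hT S).mem_toFinset.mpr ⟨v, h⟩)

theorem eq_opSum {ι : Type*} {T : ι → Module.End ℂ Fock} (hT : LocallyFinite T)
    {X : Module.End ℂ Fock} (h : ∀ v, HasSum (fun a => T a v) (X v)) : X = opSum T hT :=
  LinearMap.ext fun v => (h v).unique (hasSum_opSum hT v)

theorem continuous_opSum {ι : Type*} {T : ι → Module.End ℂ Fock} (hT : LocallyFinite T)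
    (hc : ∀ a, Continuous (T a)) : Continuous (opSum T hT) :=
  continuous_pi fun S => continuous_finsetSum _ fun a _ => (continuous_apply S).comp (hc a)

theorem hasSum_map {ι : Type*} {f : ι → Fock} {w : Fock} (hf : HasSum f w)
    {X : Module.End ℂ Fock} (hX : Continuous X) : HasSum (fun a => X (f a)) (X w) :=
  hf.map X.toAddMonoidHom hX

theorem commute_opSum {ι : Type*} {T : ι → Module.End ℂ Fock} (hT : LocallyFinite T)
    {X : Module.End ℂ Fock} (hX : Continuous X) (h : ∀ a, Commute X (T a)) :
    Commute X (opSum T hT) := by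
  refine LinearMap.ext fun v => ?_
  have h1 := hasSum_map (hasSum_opSum hT v) hX
  have h2 := hasSum_opSum hT (X v)
  have e : (fun a => X (T a v)) = fun a => T a (X v) :=
    funext fun a => LinearMap.congr_fun (h a).eq v
  rw [e] at h1
  exact h1.unique h2

theorem continuous_smul_end {T : Module.End ℂ Fock} (hT : Continuous T) (a : ℂ) :
    Continuous (a • T) := hT.const_smul a

theorem continuous_mul_end {T T' : Module.End ℂ Fock} (hT : Continuous T) (hT' : Continuous T') :
    Continuous (T * T') := hT.comp hT'

theorem continuous_pow_end {T : Module.End ℂ Fock} (hT : Continuous T) (k : ℕ) :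
    Continuous (T ^ k) := by
  induction k with
  | zero => exact continuous_id
  | succ k ih => rw [pow_succ]; exact continuous_mul_end ih hT

theorem continuous_opExp {T : Module.End ℂ Fock} (hT : Raises T) (hc : Continuous T) :
    Continuous (opExp T hT) :=
  continuous_opSum _ fun k => continuous_smul_end (continuous_pow_end hc k) _

theorem commute_opExp {T X : Module.End ℂ Fock} (hT : Raises T) (hX : Continuous X)
    (h : Commute X T) : Commute X (opExp T hT) :=
  commute_opSum _ hX fun k => (h.pow_right k).smul_right _

theorem opExp_congr {T T' : Module.End ℂ Fock} (h : T = T') (hT : Raises T) (hT' : Raises T') :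
    opExp T hT = opExp T' hT' := by
  subst h; rfl

/-! ### Exponentials of operators that raise the energy -/

/-- The divided power `T ^ k / k!`. -/
noncomputable def divPow (T : Module.End ℂ Fock) (k : ℕ) : Module.End ℂ Fock :=
  ((k.factorial : ℂ)⁻¹) • T ^ k

@[simp] theorem divPow_zero (T : Module.End ℂ Fock) : divPow T 0 = 1 := by simp [divPow]

theorem mul_divPow (T : Module.End ℂ Fock) (k : ℕ) :
    T * divPow T k = ((k + 1 : ℕ) : ℂ) • divPow T (k + 1) := by
  unfold divPow
  rw [smul_smul, mul_smul_comm, ← pow_succ', Nat.factorial_succ]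
  congr 1
  have h1 : ((k + 1 : ℕ) : ℂ) ≠ 0 := by exact_mod_cast k.succ_ne_zero
  rw [Nat.cast_mul, mul_inv, mul_inv_cancel_left₀ h1]

theorem continuous_divPow {T : Module.End ℂ Fock} (hT : Continuous T) (k : ℕ) :
    Continuous (divPow T k) := continuous_smul_end (continuous_pow_end hT k) _

theorem divPow_apply_eq_zero {T : Module.End ℂ Fock} (hT : Raises T) {k : ℕ} (v : Fock) {S : Maya}
    (h : S.energy < k) : divPow T k v S = 0 := by
  simp [divPow, hT.pow_apply k v S h]

theorem hasSum_opExp {T : Module.End ℂ Fock} (hT : Raises T) (v : Fock) :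
    HasSum (fun k => divPow T k v) (opExp T hT v) :=
  hasSum_opSum hT.locallyFinite_exp v

/-- A convergent double series may be summed along the antidiagonals. -/
theorem hasSum_antidiagonal {f : ℕ × ℕ → Fock} {w : Fock} (hf : HasSum f w) :
    HasSum (fun k => ∑ x ∈ antidiagonal k, f x) w := by
  have h := (Finset.HasAntidiagonal.sigmaAntidiagonalEquivProd (A := ℕ)).hasSum_iff.mpr hf
  refine h.sigma fun k => ?_
  simpa [Function.comp_def, Finset.sum_attach] using
    (hasSum_fintype fun x : antidiagonal k => f x)

/-- A double family with finitely many nonzero entries in each coordinate has the same sum whether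
it is summed in rows and then over the rows, or along the antidiagonals. -/
theorem hasSum_antidiagonal_of_rows {f : ℕ × ℕ → Fock} {g : ℕ → Fock} {w : Fock}
    (hf : ∀ S, {x | f x S ≠ 0}.Finite) (hg : ∀ l, HasSum (fun m => f (l, m)) (g l))
    (hw : HasSum g w) : HasSum (fun k => ∑ x ∈ antidiagonal k, f x) w := by
  have hs : Summable f := Pi.summable.mpr fun S => summable_of_hasFiniteSupport (hf S)
  have h1 := hs.hasSum.prod_fiberwise hg
  have h2 := hs.hasSum
  rw [h1.unique hw] at h2
  exact hasSum_antidiagonal h2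

/-- If the divided powers of `T` and `T'` are intertwined by `L` up to the family `X`, i.e. if
`(T^k/k!) L = ∑_{l + m = k} X_l (T'^m/m!)`, then `exp T · L = (∑_l X_l) · exp T'`. -/
theorem opExp_mul_eq {T T' L Y : Module.End ℂ Fock} (hT : Raises T) (hT' : Raises T')
    {X : ℕ → Module.End ℂ Fock} (hX : ∀ l, Continuous (X l))
    (hY : ∀ w, HasSum (fun l => X l w) (Y w))
    (h : ∀ k, divPow T k * L = ∑ x ∈ antidiagonal k, X x.1 * divPow T' x.2)
    (hfin : ∀ v S, {x : ℕ × ℕ | X x.1 (divPow T' x.2 v) S ≠ 0}.Finite) :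
    opExp T hT * L = Y * opExp T' hT' := by
  refine LinearMap.ext fun v => ?_
  have h1 := hasSum_opExp hT (L v)
  have h2 := hasSum_antidiagonal_of_rows (f := fun x => X x.1 (divPow T' x.2 v)) (hfin v)
    (fun l => hasSum_map (hasSum_opExp hT' v) (hX l)) (hY _)
  have e : (fun k => divPow T k (L v)) =
      fun k => ∑ x ∈ antidiagonal k, X x.1 (divPow T' x.2 v) :=
    funext fun k => by simpa [LinearMap.sum_apply] using LinearMap.congr_fun (h k) v
  rw [e] at h1
  exact h1.unique h2

theorem Raises.add {T T' : Module.End ℂ Fock} (hT : Raises T) (hT' : Raises T') :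
    Raises (T + T') := fun v S h => by
  simp [hT v S h, hT' v S h]

theorem Raises.zero : Raises 0 := fun _ _ _ => rfl

/-- The divided-power form of the rule for iterating `T L(F) = L(F) T + L(D F)`. -/
theorem divPow_mul_eq {M : Type*} (T : Module.End ℂ Fock) {T' : Module.End ℂ Fock}
    (L : M → Module.End ℂ Fock)
    (D : ℕ → M)
    (h : ∀ l, T * L (D l) = L (D l) * T' + ((l + 1 : ℕ) : ℂ) • L (D (l + 1))) (k : ℕ) :
    divPow T k * L (D 0) = ∑ x ∈ antidiagonal k, L (D x.1) * divPow T' x.2 := by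
  induction k with
  | zero => simp
  | succ k ih =>
    have hk : ((k + 1 : ℕ) : ℂ) ≠ 0 := by exact_mod_cast k.succ_ne_zero
    refine smul_right_injective _ hk ?_
    simp only
    rw [← smul_mul_assoc, ← mul_divPow, mul_assoc, ih, Finset.mul_sum]
    have e : ∀ x ∈ antidiagonal k, T * (L (D x.1) * divPow T' x.2) =
        ((x.2 + 1 : ℕ) : ℂ) • (L (D x.1) * divPow T' (x.2 + 1)) +
          ((x.1 + 1 : ℕ) : ℂ) • (L (D (x.1 + 1)) * divPow T' x.2) := by
      intro x _
      rw [← mul_assoc, h, add_mul, mul_assoc, mul_divPow, mul_smul_comm, smul_mul_assoc]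
    rw [Finset.sum_congr rfl e, Finset.sum_add_distrib, Finset.smul_sum]
    have h1 : ∑ x ∈ antidiagonal (k + 1), ((k + 1 : ℕ) : ℂ) • (L (D x.1) * divPow T' x.2)
        = ∑ x ∈ antidiagonal (k + 1), ((x.2 : ℕ) : ℂ) • (L (D x.1) * divPow T' x.2)
          + ∑ x ∈ antidiagonal (k + 1), ((x.1 : ℕ) : ℂ) • (L (D x.1) * divPow T' x.2) := by
      rw [← Finset.sum_add_distrib]
      refine Finset.sum_congr rfl fun x hx => ?_
      rw [← add_smul, ← Nat.cast_add, add_comm x.2, mem_antidiagonal.mp hx]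
    rw [h1, Finset.Nat.sum_antidiagonal_succ', Finset.Nat.sum_antidiagonal_succ
      (f := fun x => ((x.1 : ℕ) : ℂ) • (L (D x.1) * divPow T' x.2))]
    simp

theorem opExp_add {T T' : Module.End ℂ Fock} (hT : Raises T) (hT' : Raises T')
    (hc : Continuous T) (h : Commute T T') :
    opExp (T + T') (hT.add hT') = opExp T hT * opExp T' hT' := by
  have key := opExp_mul_eq (T := T + T') (T' := T') (L := 1) (X := divPow T) (Y := opExp T hT)
    (hT.add hT') hT' (continuous_divPow hc) (hasSum_opExp hT) (fun k => ?_) (fun v S => ?_)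
  · rwa [mul_one] at key
  · have := divPow_mul_eq (M := ℕ) (T + T') (T' := T') (divPow T) id (fun l => ?_) k
    · simpa using this
    · simp only [id]
      rw [add_mul, mul_divPow, add_comm]
      congr 1
      exact ((h.symm.pow_right l).smul_right _).eq
  -- `T ^ l` raises the energy by at least `l`, so only terms with `l + m ≤ S.energy` contribute.
  · have hz : ∀ (l : ℕ) (w : Fock) (B : ℤ), (∀ S : Maya, S.energy < B → w S = 0) →
        ∀ S : Maya, S.energy < B + l → divPow T l w S = 0 := by
      intro l
      induction l with
      | zero => intro w B hw S hS; simpa using hw S (by simpa using hS)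
      | succ l ih =>
        intro w B hw S hS
        have e : divPow T (l + 1) w S = ((l + 1 : ℕ) : ℂ)⁻¹ * T (divPow T l w) S := by
          have hk : ((l + 1 : ℕ) : ℂ) ≠ 0 := by exact_mod_cast l.succ_ne_zero
          have := congrFun (LinearMap.congr_fun (mul_divPow T l) w) S
          simp only [Module.End.mul_apply, LinearMap.smul_apply, Pi.smul_apply, smul_eq_mul] at this
          rw [this, inv_mul_cancel_left₀ hk]
        rw [e, hT _ S fun S' h' => ih w B hw S' ?_, mul_zero]
        push_cast at hS
        omega
    refine ((Set.finite_le_nat S.energy.toNat).prod (Set.finite_le_nat S.energy.toNat)).subset ?_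
    rintro ⟨l, m⟩ hx
    have : ¬ S.energy < (m : ℤ) + l := fun hS => hx (hz l _ m (fun S' h' =>
      divPow_apply_eq_zero hT' v h') S hS)
    have := S.energy_nonneg
    constructor <;> simp <;> omega

theorem opExp_zero (h : Raises 0) : opExp 0 h = 1 := by
  refine LinearMap.ext fun v => (hasSum_opExp h v).unique ?_
  have e : (fun k => divPow 0 k v) = fun k => if k = 0 then v else 0 := by
    funext k
    rcases k with _ | k
    · simp
    · simp [divPow]
  rw [e]
  exact hasSum_ite_eq (0 : ℕ) v

theorem Raises.sum {ι : Type*} (s : Finset ι) {T : ι → Module.End ℂ Fock}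
    (hT : ∀ c, Raises (T c)) : Raises (∑ c ∈ s, T c) := by
  classical
  induction s using Finset.induction_on with
  | empty => simpa using Raises.zero
  | insert a s ha ih => rw [Finset.sum_insert ha]; exact (hT a).add ih

theorem opExp_sum {n : ℕ} (T : Fin n → Module.End ℂ Fock) (hT : ∀ c, Raises (T c))
    (hc : ∀ c, Continuous (T c)) (h : ∀ c c', c ≠ c' → Commute (T c) (T c')) :
    opExp (∑ c, T c) (Raises.sum _ hT) = (List.ofFn fun c => opExp (T c) (hT c)).prod := by
  induction n with
  | zero => simpa using opExp_zero _
  | succ n ih =>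
    rw [List.ofFn_succ, List.prod_cons, ← ih (fun c => T c.succ) (fun c => hT _) (fun c => hc _)
      (fun c c' hcc => h _ _ (by simpa using hcc)), ← opExp_add _ _ (hc 0)]
    · exact opExp_congr (Fin.sum_univ_succ _) _ _
    · exact Commute.sum_right _ _ _ fun c _ => h _ _ (Fin.succ_ne_zero c).symm

/-! ### Canonical anticommutation relations -/

namespace Maya

@[simp] theorem mem_fill {S : Maya} {i j : ℤ} : j ∈ (S.fill i).occ ↔ j = i ∨ j ∈ S.occ := Iff.rfl

@[simp] theorem mem_clear {S : Maya} {i j : ℤ} : j ∈ (S.clear i).occ ↔ j ∈ S.occ ∧ j ≠ i := Iff.rfl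

theorem finite_above (S : Maya) (i : ℤ) : {s | s ∈ S.occ ∧ i < s}.Finite := by
  refine (S.particles_finite.union (Set.finite_Ioo i 0)).subset ?_
  rintro s ⟨h1, h2⟩
  rcases lt_or_ge s 0 with h | h
  · exact Or.inr ⟨h2, h⟩
  · exact Or.inl ⟨h1, h⟩

theorem sgn_fill {S : Maya} {j : ℤ} (hj : j ∉ S.occ) (i : ℤ) :
    (S.fill j).sgn i = (if i < j then -1 else 1) * S.sgn i := by
  unfold sgn
  split_ifs with h
  · have e : {s | s ∈ (S.fill j).occ ∧ i < s} = insert j {s | s ∈ S.occ ∧ i < s} := by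
      ext s
      simp only [mem_fill, Set.mem_ofPred_eq, Set.mem_insert_iff]
      constructor
      · tauto
      · rintro (rfl | h') <;> tauto
    rw [e, Set.ncard_insert_of_notMem (fun h' => hj h'.1) (S.finite_above i), pow_succ']
  · have e : {s | s ∈ (S.fill j).occ ∧ i < s} = {s | s ∈ S.occ ∧ i < s} := by
      ext s
      simp only [mem_fill, Set.mem_ofPred_eq]
      constructor
      · rintro ⟨rfl | h1, h2⟩ <;> tauto
      · tauto
    rw [e, one_mul]

theorem fill_clear {S : Maya} {i : ℤ} (hi : i ∈ S.occ) : (S.clear i).fill i = S := by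
  ext x
  simp only [mem_fill, mem_clear]
  by_cases h : x = i
  · simp [h, hi]
  · simp [h]

theorem clear_fill {S : Maya} {i : ℤ} (hi : i ∉ S.occ) : (S.fill i).clear i = S := by
  ext x
  simp only [mem_fill, mem_clear]
  by_cases h : x = i
  · simp [h, hi]
  · simp [h]

theorem sgn_clear {S : Maya} {j : ℤ} (hj : j ∈ S.occ) (i : ℤ) :
    (S.clear j).sgn i = (if i < j then -1 else 1) * S.sgn i := by
  have h := sgn_fill (S := S.clear j) (j := j) (by simp) i
  rw [fill_clear hj] at h
  rw [h]
  split_ifs <;> simp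

theorem sgn_mul_self (S : Maya) (i : ℤ) : S.sgn i * S.sgn i = 1 := by
  unfold sgn
  rw [← pow_add, Even.neg_one_pow ⟨_, rfl⟩]

end Maya

open Classical in
theorem psi_apply (i : ℤ) (v : Fock) (S : Maya) :
    psi i v S = if i ∈ S.occ then S.sgn i * v (S.clear i) else 0 := rfl

open Classical in
theorem psiDag_apply (i : ℤ) (v : Fock) (S : Maya) :
    psiDag i v S = if i ∈ S.occ then 0 else S.sgn i * v (S.fill i) := rfl

theorem psi_mul_psi (i j : ℤ) : psi i * psi j = -(psi j * psi i) := by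
  ext v S
  simp only [Module.End.mul_apply, LinearMap.neg_apply, Pi.neg_apply, psi_apply, Maya.mem_clear]
  rcases eq_or_ne i j with rfl | hij
  · simp
  by_cases hi : i ∈ S.occ <;> by_cases hj : j ∈ S.occ <;> simp [hi, hj, hij, hij.symm]
  have e : (S.clear j).clear i = (S.clear i).clear j := by
    ext x; simp; tauto
  rw [Maya.sgn_clear hi, Maya.sgn_clear hj, e]
  rcases lt_or_gt_of_ne hij with h | h <;> simp [h, h.not_gt] <;> ring

theorem psiDag_mul_psiDag (i j : ℤ) : psiDag i * psiDag j = -(psiDag j * psiDag i) := by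
  ext v S
  simp only [Module.End.mul_apply, LinearMap.neg_apply, Pi.neg_apply, psiDag_apply, Maya.mem_fill]
  rcases eq_or_ne i j with rfl | hij
  · simp
  by_cases hi : i ∈ S.occ <;> by_cases hj : j ∈ S.occ <;> simp [hi, hj, hij, hij.symm]
  have e : (S.fill j).fill i = (S.fill i).fill j := by
    ext x; simp; tauto
  rw [Maya.sgn_fill hi, Maya.sgn_fill hj, e]
  rcases lt_or_gt_of_ne hij with h | h <;> simp [h, h.not_gt] <;> ring

theorem psiDag_mul_psi {i j : ℤ} (hij : i ≠ j) : psiDag i * psi j = -(psi j * psiDag i) := by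
  ext v S
  simp only [Module.End.mul_apply, LinearMap.neg_apply, Pi.neg_apply, psi_apply, psiDag_apply,
    Maya.mem_fill, Maya.mem_clear]
  by_cases hi : i ∈ S.occ <;> by_cases hj : j ∈ S.occ <;> simp [hi, hj, hij, hij.symm]
  have e : (S.fill i).clear j = (S.clear j).fill i := by
    ext x
    simp only [Maya.mem_fill, Maya.mem_clear]
    by_cases h : x = i
    · simp [h, hij]
    · simp [h]
  rw [Maya.sgn_fill hi, Maya.sgn_clear hj, e]
  rcases lt_or_gt_of_ne hij with h | h <;> simp [h, h.not_gt] <;> ring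

theorem psiDag_mul_psi_self (i : ℤ) : psiDag i * psi i = 1 - psi i * psiDag i := by
  ext v S
  simp only [Module.End.mul_apply, LinearMap.sub_apply, Pi.sub_apply, psi_apply, psiDag_apply,
    Maya.mem_fill, Maya.mem_clear, Module.End.one_apply]
  by_cases hi : i ∈ S.occ
  · simp [hi, Maya.sgn_clear hi, Maya.fill_clear hi, ← mul_assoc, Maya.sgn_mul_self]
  · simp [hi, Maya.sgn_fill hi, Maya.clear_fill hi, ← mul_assoc, Maya.sgn_mul_self]

theorem continuous_psi (i : ℤ) : Continuous (psi i) := by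
  refine continuous_pi fun S => ?_
  simp only [psi_apply]
  split_ifs
  · exact continuous_const.mul (continuous_apply _)
  · exact continuous_const

theorem continuous_psiDag (i : ℤ) : Continuous (psiDag i) := by
  refine continuous_pi fun S => ?_
  simp only [psiDag_apply]
  split_ifs
  · exact continuous_const
  · exact continuous_const.mul (continuous_apply _)

theorem continuous_bilinear {i j : ℤ} (h : i ≠ j) : Continuous (bilinear i j) := by
  rw [bilinear_of_ne h]
  exact continuous_mul_end (continuous_psi i) (continuous_psiDag j)

theorem ket_fill {S : Maya} {i : ℤ} (hi : i ∉ S.occ) :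
    psi i (ket S) = S.sgn i • ket (S.fill i) := by
  classical
  ext S'
  simp only [psi_apply, ket, Pi.smul_apply, Pi.single_apply, smul_eq_mul]
  by_cases h : S' = S.fill i
  · subst h
    simp [Maya.clear_fill hi, Maya.sgn_fill hi]
  · have h2 : i ∈ S'.occ → S'.clear i ≠ S := by
      rintro h1 rfl
      exact h (Maya.fill_clear h1).symm
    by_cases h1 : i ∈ S'.occ
    · simp [h, h2 h1]
    · simp [h, h1]

/-- For the negation of `Module.End ℂ Fock` as a space of linear maps, which `rw` and `simp` do not
identify with the one in `mul_neg`. -/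
theorem mul_neg_end (X Y : Module.End ℂ Fock) : X * -Y = -(X * Y) :=
  LinearMap.ext fun v => map_neg X (Y v)

theorem neg_mul_end (X Y : Module.End ℂ Fock) : -X * Y = -(X * Y) := rfl

theorem commute_bilinear {i j k l : ℤ} (hij : i ≠ j) (hkl : k ≠ l) (hjk : j ≠ k) (hil : i ≠ l) :
    Commute (bilinear i j) (bilinear k l) := by
  rw [bilinear_of_ne hij, bilinear_of_ne hkl, commute_iff_eq]
  calc psi i * psiDag j * (psi k * psiDag l)
      = psi i * (psiDag j * psi k) * psiDag l := by simp only [mul_assoc]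
    _ = -((psi i * psi k) * (psiDag j * psiDag l)) := by
      rw [psiDag_mul_psi hjk]; simp only [mul_assoc, mul_neg_end, neg_mul_end]
    _ = -((psi k * psi i) * (psiDag l * psiDag j)) := by
      rw [psi_mul_psi i k, psiDag_mul_psiDag j l]; simp only [mul_neg_end, neg_mul_end, neg_neg]
    _ = psi k * -(psi i * psiDag l) * psiDag j := by simp only [mul_assoc, mul_neg_end, neg_mul_end]
    _ = psi k * psiDag l * (psi i * psiDag j) := by
      rw [← psiDag_mul_psi hil.symm]; simp only [mul_assoc]

/-- `[:ψ_i ψ†_j:, ψ_y] = δ_{jy} ψ_i` for `i ≠ j`. -/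
theorem bilinear_mul_psi {i j : ℤ} (hij : i ≠ j) (y : ℤ) :
    bilinear i j * psi y = psi y * bilinear i j + if j = y then psi i else 0 := by
  rw [bilinear_of_ne hij]
  split_ifs with h
  · subst h
    rw [mul_assoc, psiDag_mul_psi_self, mul_sub, mul_one, ← mul_assoc, ← mul_assoc, psi_mul_psi j i]
    simp only [neg_mul_end]
    abel
  · rw [mul_assoc, psiDag_mul_psi h, mul_neg_end, ← mul_assoc, psi_mul_psi i y]
    simp [mul_assoc, neg_mul_end]

/-! ### Factorization of the flow -/

theorem current_index_ne (e : ℤ ↪o ℤ) (q n : ℕ+) (i : ℤ) :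
    e i ≠ e (i - ((q : ℕ) : ℤ) * ((n : ℕ) : ℤ)) := fun h => by
  have := e.injective h
  have := step_pos q n
  omega

theorem continuous_current (e : ℤ ↪o ℤ) (q : ℕ+) (r : ℤ → ℂ) (n : ℕ+) :
    Continuous (current e q r n) :=
  continuous_opSum _ fun i => continuous_smul_end (continuous_bilinear (current_index_ne e q n i)) _

/-- The exponent `∑_{n > 0} (1/n) t_n A_n` of a flow. -/
noncomputable def generator (e : ℤ ↪o ℤ) (q : ℕ+) (r : ℤ → ℂ) (t : ℕ → ℂ) : Module.End ℂ Fock :=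
  opSum (fun n : ℕ+ => (t n / (n : ℕ)) • current e q r n) (locallyFinite_generator e q r t)

theorem raises_generator (e : ℤ ↪o ℤ) (q : ℕ+) (r : ℤ → ℂ) (t : ℕ → ℂ) :
    Raises (generator e q r t) :=
  raises_opSum _ fun n => (raises_current e q r n).smul _

theorem continuous_generator (e : ℤ ↪o ℤ) (q : ℕ+) (r : ℤ → ℂ) (t : ℕ → ℂ) :
    Continuous (generator e q r t) :=
  continuous_opSum _ fun n => continuous_smul_end (continuous_current e q r n) _

/-- Flows built from fermions on disjoint sets of sites have commuting generators. -/
theorem commute_generator {e e' : ℤ ↪o ℤ} (h : ∀ i j, e i ≠ e' j) (q q' : ℕ+) (r r' : ℤ → ℂ)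
    (t t' : ℕ → ℂ) : Commute (generator e q r t) (generator e' q' r' t') := by
  refine commute_opSum _ (continuous_generator ..) fun n' => Commute.smul_right ?_ _
  refine commute_opSum _ (continuous_generator ..) fun i' => Commute.smul_right ?_ _
  have hb := continuous_bilinear (current_index_ne e' q' n' i')
  refine (commute_opSum _ hb fun n => Commute.smul_right ?_ _).symm
  refine commute_opSum _ hb fun i => Commute.smul_right ?_ _
  exact (commute_bilinear (current_index_ne e q n i) (current_index_ne e' q' n' i')
    (h _ _) (h _ _)).symm

theorem commute_flow {e e' : ℤ ↪o ℤ} (h : ∀ i j, e i ≠ e' j) (q q' : ℕ+) (r r' : ℤ → ℂ)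
    (t t' : ℕ → ℂ) : Commute (flow e q r t) (flow e' q' r' t') := by
  refine commute_opExp _ (continuous_opExp (raises_generator _ _ _ _) (continuous_generator ..)) ?_
  exact (commute_opExp _ (continuous_generator ..) (commute_generator h q q' r r' t t').symm).symm

theorem colourSite_apply (p : ℕ+) (c i : ℤ) : colourSite p c i = ((p : ℕ) : ℤ) * i + c := rfl

theorem mul_add_inj {p : ℕ+} {c c' : Fin p} {i j : ℤ}
    (h : ((p : ℕ) : ℤ) * i + (c : ℕ) = ((p : ℕ) : ℤ) * j + (c' : ℕ)) : c = c' ∧ i = j := by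
  have hc : ((c : ℕ) : ℤ) < ((p : ℕ) : ℤ) := by exact_mod_cast c.2
  have hc' : ((c' : ℕ) : ℤ) < ((p : ℕ) : ℤ) := by exact_mod_cast c'.2
  have h1 : ((c : ℕ) : ℤ) = ((c' : ℕ) : ℤ) := by
    have := congrArg (· % ((p : ℕ) : ℤ)) h
    simpa [Int.mul_add_emod_self_left, Int.emod_eq_of_lt (Int.natCast_nonneg _) hc,
      Int.emod_eq_of_lt (Int.natCast_nonneg _) hc'] using this
  have hp : ((p : ℕ) : ℤ) ≠ 0 := by exact_mod_cast p.ne_zero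
  exact ⟨Fin.ext (by exact_mod_cast h1), mul_left_cancel₀ hp (by omega)⟩

theorem colourSite_ne {p : ℕ+} {c c' : Fin p} (h : c ≠ c') (i j : ℤ) :
    colourSite p (c : ℕ) i ≠ colourSite p (c' : ℕ) j := fun e => h (mul_add_inj e).1

/-- A series over `ℤ` is the sum of its restrictions to the residue classes modulo `p`. -/
theorem hasSum_residues (p : ℕ+) {f : ℤ → Fock} {s : Fin p → Fock}
    (h : ∀ c : Fin p, HasSum (fun i : ℤ => f (((p : ℕ) : ℤ) * i + (c : ℕ))) (s c)) :
    HasSum f (∑ c, s c) := by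
  classical
  have h1 : ∀ c : Fin p, HasSum
      (fun x => if x % ((p : ℕ) : ℤ) = (c : ℕ) then f x else 0) (s c) := by
    intro c
    have hc : ((c : ℕ) : ℤ) < ((p : ℕ) : ℤ) := by exact_mod_cast c.2
    have hinj : Function.Injective fun i : ℤ => ((p : ℕ) : ℤ) * i + (c : ℕ) :=
      fun i j hij => (mul_add_inj hij).2
    refine (hinj.hasSum_iff ?_).mp ?_
    · intro x hx
      rw [if_neg]
      intro hxc
      refine hx ⟨x / ((p : ℕ) : ℤ), ?_⟩
      have := Int.mul_ediv_add_emod x ((p : ℕ) : ℤ)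
      simp only
      omega
    · convert h c using 2 with i
      simp [Int.mul_add_emod_self_left, Int.emod_eq_of_lt (Int.natCast_nonneg _) hc]
  convert hasSum_sum fun c (_ : c ∈ Finset.univ) => h1 c using 2 with x
  have hp : (0 : ℤ) < ((p : ℕ) : ℤ) := by exact_mod_cast p.pos
  have hx0 := Int.emod_nonneg x hp.ne'
  have hx1 := Int.emod_lt_of_pos x hp
  rw [Finset.sum_eq_single_of_mem (⟨(x % ((p : ℕ) : ℤ)).toNat, by omega⟩ : Fin p)
    (Finset.mem_univ _)]
  · simp [hx0]
  · intro c _ hc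
    rw [if_neg]
    intro h'
    exact hc (Fin.ext (by simp [h']))

theorem current_eq_sum (p : ℕ+) (r : ℤ → ℂ) (n : ℕ+) :
    current (RelEmbedding.refl _) p r n =
      ∑ c : Fin p, current (colourSite p (c : ℕ)) 1 (colourFun p (c : ℕ) r) n := by
  symm
  refine eq_opSum _ fun v => ?_
  rw [LinearMap.sum_apply]
  refine hasSum_residues p fun c => ?_
  have h : HasSum _ (current (colourSite p (c : ℕ)) 1 (colourFun p (c : ℕ) r) n v) :=
    hasSum_opSum _ v
  have e : ∀ i k : ℤ, ((p : ℕ) : ℤ) * (i - k) + (c : ℕ) =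
      ((p : ℕ) : ℤ) * i + (c : ℕ) - ((p : ℕ) : ℤ) * k := fun i k => by ring
  simpa only [RelEmbedding.refl_apply, colourFun, colourSite_apply, PNat.val_ofNat, Nat.cast_one,
    one_mul, e] using h

theorem generator_eq_sum (p : ℕ+) (r : ℤ → ℂ) (t : ℕ → ℂ) :
    generator (RelEmbedding.refl _) p r t =
      ∑ c : Fin p, generator (colourSite p (c : ℕ)) 1 (colourFun p (c : ℕ) r) t := by
  symm
  refine eq_opSum _ fun v => ?_
  simp only [current_eq_sum, LinearMap.sum_apply, Finset.smul_sum]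
  exact hasSum_sum fun c _ => hasSum_opSum (locallyFinite_generator _ _ _ _) v

theorem commute_colourGam (p : ℕ+) (r : ℤ → ℂ) (t : ℕ → ℂ) (c c' : Fin p) :
    Commute (colourGam p (c : ℕ) (colourFun p (c : ℕ) r) t)
      (colourGam p (c' : ℕ) (colourFun p (c' : ℕ) r) t) := by
  rcases eq_or_ne c c' with rfl | h
  · exact Commute.refl _
  · exact commute_flow (colourSite_ne h) ..

theorem Gam_eq_prod (p : ℕ+) (r : ℤ → ℂ) (t : ℕ → ℂ) :
    Gam p r t =
      (List.ofFn fun c : Fin p => colourGam p (c : ℕ) (colourFun p (c : ℕ) r) t).prod := by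
  refine Eq.trans ?_ (opExp_sum
    (fun c : Fin p => generator (colourSite p (c : ℕ)) 1 (colourFun p (c : ℕ) r) t)
    (fun c => raises_generator _ _ _ _) (fun c => continuous_generator ..)
    (fun c c' h => commute_generator (colourSite_ne h) ..))
  exact opExp_congr (generator_eq_sum p r t) (raises_generator _ _ _ _) _

/-! ### Conjugating fermions by the flow -/

/-- The exponent `∑_{m > 0} (1/m) t_m z^m`. -/
noncomputable def exponent (t : ℕ → ℂ) : ℂ⟦X⟧ := PowerSeries.mk fun m : ℕ => t m / (m : ℂ)

/-- The `l`-th term `P^l / l!` of the exponential series of `P = exponent t`. -/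
noncomputable def expTerm (t : ℕ → ℂ) (l : ℕ) : ℂ⟦X⟧ := ((l.factorial : ℂ)⁻¹) • exponent t ^ l

theorem hasSubst_exponent (t : ℕ → ℂ) : HasSubst (exponent t) :=
  HasSubst.of_constantCoeff_zero' (by
    rw [← PowerSeries.coeff_zero_eq_constantCoeff_apply, exponent, PowerSeries.coeff_mk]; simp)

theorem X_dvd_exponent (t : ℕ → ℂ) : X ∣ exponent t := by
  rw [PowerSeries.X_dvd_iff, ← PowerSeries.coeff_zero_eq_constantCoeff_apply, exponent,
    PowerSeries.coeff_mk]
  simp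

theorem coeff_expTerm_of_lt (t : ℕ → ℂ) {k l : ℕ} (h : k < l) : coeff k (expTerm t l) = 0 := by
  have := PowerSeries.X_pow_dvd_iff.mp (pow_dvd_pow_of_dvd (X_dvd_exponent t) l) k h
  simp [expTerm, this]

theorem hasSum_coeff_expTerm (t : ℕ → ℂ) (k : ℕ) :
    HasSum (fun l => coeff k (expTerm t l)) (complete t k) := by
  have h0 : complete t k = coeff k ((PowerSeries.exp ℂ).subst (exponent t)) := by
    simp [complete, exponent]
  have h1 : ∀ l, coeff l (PowerSeries.exp ℂ) • coeff k (exponent t ^ l) =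
      coeff k (expTerm t l) := by
    intro l
    simp [expTerm, PowerSeries.coeff_exp]
  rw [h0, PowerSeries.coeff_subst' (hasSubst_exponent t)]
  simp only [h1]
  rw [finsum_eq_sum_of_support_subset (s := Finset.range (k + 1))]
  · refine hasSum_sum_of_ne_finset_zero fun l hl => coeff_expTerm_of_lt t ?_
    simpa using hl
  · intro l hl
    by_contra h
    exact hl (coeff_expTerm_of_lt t (by simpa using h))

/-- The weight `r(y + p) r(y + 2p) ⋯ r(y + k p)` of `k` steps of length `p` up from `y`. -/
noncomputable def weight (p : ℕ+) (r : ℤ → ℂ) (y : ℤ) (k : ℕ) : ℂ :=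
  ∏ m ∈ Finset.range k, r (y + ((p : ℕ) : ℤ) * ((m : ℤ) + 1))

/-- Consecutive walks compose: this makes `A_{np}(r)` the `n`-th power of `A_p(r)` on one particle.
-/
theorem weight_add (p : ℕ+) (r : ℤ → ℂ) (y : ℤ) (k n : ℕ) :
    weight p r y (k + n) = weight p r y k * weight p r (y + ((p : ℕ) : ℤ) * k) n := by
  unfold weight
  rw [Finset.prod_range_add]
  congr 1
  refine Finset.prod_congr rfl fun m _ => congrArg r ?_
  push_cast
  ring

theorem finite_steps (p : ℕ+) (y : ℤ) (S : Maya) :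
    {k : ℕ | y + ((p : ℕ) : ℤ) * k ∈ S.occ}.Finite := by
  have hp : (0 : ℤ) < ((p : ℕ) : ℤ) := by exact_mod_cast p.pos
  refine ((S.finite_above (y - 1)).preimage (f := fun k : ℕ => y + ((p : ℕ) : ℤ) * k) ?_).subset ?_
  · intro a _ b _ h
    have := mul_left_cancel₀ hp.ne' (add_left_cancel h)
    exact_mod_cast this
  · intro k hk
    refine ⟨hk, ?_⟩
    show y - 1 < y + ((p : ℕ) : ℤ) * k
    have : (0 : ℤ) ≤ ((p : ℕ) : ℤ) * k := by positivity
    omega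

theorem mem_occ_of_psi_ne_zero {i : ℤ} {v : Fock} {S : Maya} (h : psi i v S ≠ 0) : i ∈ S.occ := by
  by_contra h'
  exact h (by simp [psi_apply, h'])

theorem locallyFinite_field (p : ℕ+) (y : ℤ) (a : ℕ → ℂ) :
    LocallyFinite fun k : ℕ => a k • psi (y + ((p : ℕ) : ℤ) * k) := by
  refine fun S => (finite_steps p y S).subset ?_
  rintro k ⟨v, hv⟩
  refine mem_occ_of_psi_ne_zero (v := v) fun h => hv ?_
  simp [h]

/-- The field `∑_k F_k r(y + p) ⋯ r(y + k p) ψ_{y + k p}` of a power series `F = ∑_k F_k z^k`. The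
series `1` gives `ψ_y`, and multiplying by `z` corresponds to the commutator with `A_p(r)`. -/
noncomputable def field (p : ℕ+) (r : ℤ → ℂ) (y : ℤ) (F : ℂ⟦X⟧) : Module.End ℂ Fock :=
  opSum (fun k : ℕ => (coeff k F * weight p r y k) • psi (y + ((p : ℕ) : ℤ) * k))
    (locallyFinite_field p y _)

theorem hasSum_field (p : ℕ+) (r : ℤ → ℂ) (y : ℤ) (F : ℂ⟦X⟧) (v : Fock) :
    HasSum (fun k : ℕ => (coeff k F * weight p r y k) • psi (y + ((p : ℕ) : ℤ) * k) v)
      (field p r y F v) :=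
  hasSum_opSum (locallyFinite_field p y fun k => coeff k F * weight p r y k) v

theorem continuous_field (p : ℕ+) (r : ℤ → ℂ) (y : ℤ) (F : ℂ⟦X⟧) : Continuous (field p r y F) :=
  continuous_opSum _ fun _ => continuous_smul_end (continuous_psi _) _

theorem field_smul (p : ℕ+) (r : ℤ → ℂ) (y : ℤ) (a : ℂ) (F : ℂ⟦X⟧) :
    field p r y (a • F) = a • field p r y F := by
  refine (eq_opSum _ fun v => ?_).symm
  have := (hasSum_field p r y F v).const_smul a
  simpa [smul_smul, mul_assoc] using this

theorem field_one (p : ℕ+) (r : ℤ → ℂ) (y : ℤ) : field p r y 1 = psi y := by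
  refine (eq_opSum _ fun v => ?_).symm
  have e : (fun k : ℕ => ((coeff k (1 : ℂ⟦X⟧) * weight p r y k) •
      psi (y + ((p : ℕ) : ℤ) * k)) v) = fun k => if k = 0 then psi y v else 0 := by
    funext k
    rcases k with _ | k <;> simp [PowerSeries.coeff_one, weight]
  rw [e]
  exact hasSum_ite_eq 0 _

/-- `[A_{np}(r), ψ_y] = r(y + p) ⋯ r(y + n p) ψ_{y + n p}`. -/
theorem current_mul_psi (p : ℕ+) (r : ℤ → ℂ) (n : ℕ+) (y : ℤ) :
    current (RelEmbedding.refl _) p r n * psi y =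
      psi y * current (RelEmbedding.refl _) p r n +
        weight p r y n • psi (y + ((p : ℕ) : ℤ) * ((n : ℕ) : ℤ)) := by
  refine LinearMap.ext fun v => ?_
  have h1 : HasSum _ (current (RelEmbedding.refl _) p r n (psi y v)) := hasSum_opSum _ _
  have h2 : HasSum _ (psi y (current (RelEmbedding.refl _) p r n v)) :=
    hasSum_map (hasSum_opSum _ _) (continuous_psi y)
  have h3 := h2.add (hasSum_ite_eq (y + ((p : ℕ) : ℤ) * ((n : ℕ) : ℤ))
    (weight p r y n • psi (y + ((p : ℕ) : ℤ) * ((n : ℕ) : ℤ)) v))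
  refine h1.unique (h3.congr_fun fun i => ?_)
  have h := LinearMap.congr_fun
    (bilinear_mul_psi (current_index_ne (RelEmbedding.refl _) p n i) y) v
  simp only [RelEmbedding.refl_apply, Module.End.mul_apply, LinearMap.add_apply] at h
  simp only [RelEmbedding.refl_apply, LinearMap.smul_apply, map_smul]
  rw [h, smul_add]
  congr 1
  by_cases hi : i - ((p : ℕ) : ℤ) * ((n : ℕ) : ℤ) = y
  · have hi' : i = y + ((p : ℕ) : ℤ) * ((n : ℕ) : ℤ) := by omega
    rw [if_pos hi, if_pos hi', hi', weight, ← Finset.prod_range_reflect]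
    congr 1
    refine Finset.prod_congr rfl fun m hm => congrArg r ?_
    have : m < n := Finset.mem_range.mp hm
    have : ((n - 1 - m : ℕ) : ℤ) = n - 1 - m := by omega
    rw [this]
    ring
  · rw [if_neg hi, if_neg (by omega)]
    simp

/-- The commutator of the generator with `ψ_y` is the field of `∑_m (1/m) t_m z^m`. -/
theorem generator_mul_psi (p : ℕ+) (r : ℤ → ℂ) (t : ℕ → ℂ) (y : ℤ) :
    generator (RelEmbedding.refl _) p r t * psi y =
      psi y * generator (RelEmbedding.refl _) p r t + field p r y (exponent t) := by
  refine LinearMap.ext fun v => ?_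
  have h1 : HasSum _ (generator (RelEmbedding.refl _) p r t (psi y v)) := hasSum_opSum _ _
  have h2 : HasSum _ (psi y (generator (RelEmbedding.refl _) p r t v)) :=
    hasSum_map (hasSum_opSum _ _) (continuous_psi y)
  have h3 := (PNat.coe_injective.hasSum_iff ?_).mpr (hasSum_field p r y (exponent t) v)
  · have h4 := h2.add h3
    refine h1.unique (h4.congr_fun fun n => ?_)
    have := LinearMap.congr_fun (current_mul_psi p r n y) v
    simp only [Module.End.mul_apply, LinearMap.add_apply, LinearMap.smul_apply] at this
    simp [this, exponent, smul_smul]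
  -- The term `m = 0` of the field is absent from the generator; its coefficient is `t 0 / 0 = 0`.
  · intro k hk
    have : k = 0 := by
      by_contra h
      exact hk ⟨⟨k, Nat.pos_of_ne_zero h⟩, rfl⟩
    subst this
    simp [exponent]

/-- If the commutator of `T` with each `ψ_y` is the field of the series `P`, then commuting `T` with
a field multiplies the series of the field by `P`. -/
theorem mul_field_of_mul_psi {p : ℕ+} {r : ℤ → ℂ} {T : Module.End ℂ Fock} (hc : Continuous T)
    {P : ℂ⟦X⟧} (hT : ∀ y, T * psi y = psi y * T + field p r y P) (y : ℤ) (F : ℂ⟦X⟧) :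
    T * field p r y F = field p r y F * T + field p r y (F * P) := by
  refine LinearMap.ext fun v => ?_
  have h1 := hasSum_map (hasSum_field p r y F v) hc
  have h2 := hasSum_field p r y F (T v)
  let f : ℕ × ℕ → Fock := fun x => (coeff x.1 F * weight p r y x.1) •
      (coeff x.2 P * weight p r (y + ((p : ℕ) : ℤ) * x.1) x.2) •
        psi (y + ((p : ℕ) : ℤ) * x.1 + ((p : ℕ) : ℤ) * x.2) v
  have hrow : ∀ k, HasSum (fun n => f (k, n))
      ((coeff k F * weight p r y k) • field p r (y + ((p : ℕ) : ℤ) * k) P v) :=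
    fun k => (hasSum_field p r _ P v).const_smul _
  have hfin : ∀ S, {x | f x S ≠ 0}.Finite := by
    intro S
    refine ((finite_steps p y S).biUnion (t := fun k => {x : ℕ × ℕ | x.1 + x.2 = k})
      fun k _ => ?_).subset ?_
    · refine (antidiagonal k).finite_toSet.subset fun x hx => ?_
      simpa using hx
    · intro x hx
      simp only [Set.mem_iUnion]
      refine ⟨x.1 + x.2, ?_, rfl⟩
      have h : psi (y + ((p : ℕ) : ℤ) * x.1 + ((p : ℕ) : ℤ) * x.2) v S ≠ 0 :=
        fun h => hx (by simp [f, h])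
      have := mem_occ_of_psi_ne_zero h
      simpa [mul_add, add_assoc] using this
  have hcol : HasSum (fun k => (coeff k F * weight p r y k) •
      field p r (y + ((p : ℕ) : ℤ) * k) P v) (T (field p r y F v) - field p r y F (T v)) := by
    refine (h1.sub h2).congr_fun fun k => ?_
    have h : T (psi (y + ((p : ℕ) : ℤ) * k) v) = _ :=
      LinearMap.congr_fun (hT (y + ((p : ℕ) : ℤ) * k)) v
    simp only [Module.End.mul_apply, LinearMap.add_apply] at h
    rw [map_smul, h, smul_add, add_sub_cancel_left]
  have h3 := hasSum_antidiagonal_of_rows hfin hrow hcol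
  have h5 : field p r y (F * P) v = T (field p r y F v) - field p r y F (T v) := by
    refine (hasSum_field p r y (F * P) v).unique (h3.congr_fun fun k => ?_)
    rw [PowerSeries.coeff_mul, Finset.sum_mul, Finset.sum_smul]
    refine Finset.sum_congr rfl fun x hx => ?_
    rw [← mem_antidiagonal.mp hx, weight_add]
    simp only [f]
    rw [smul_smul]
    congr 1
    · ring
    · push_cast
      rw [mul_add, add_assoc]
  simp [h5]

theorem expTerm_mul_exponent (t : ℕ → ℂ) (l : ℕ) :
    expTerm t l * exponent t = ((l + 1 : ℕ) : ℂ) • expTerm t (l + 1) := by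
  have h1 : ((l + 1 : ℕ) : ℂ) ≠ 0 := by exact_mod_cast l.succ_ne_zero
  unfold expTerm
  rw [smul_mul_assoc, ← pow_succ, smul_smul, Nat.factorial_succ, Nat.cast_mul, mul_inv,
    mul_inv_cancel_left₀ h1]

/-- `∑_k h_k(t) z^k`. -/
noncomputable def completeSeries (t : ℕ → ℂ) : ℂ⟦X⟧ := PowerSeries.mk fun k => complete t k

/-- In each coordinate a field is a sum over a finite set that does not depend on its series. -/
theorem exists_field_apply (p : ℕ+) (r : ℤ → ℂ) (y : ℤ) (S : Maya) :
    ∃ s : Finset ℕ, ∀ F v, field p r y F v S =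
      ∑ k ∈ s, coeff k F * weight p r y k * psi (y + ((p : ℕ) : ℤ) * k) v S := by
  refine ⟨(finite_steps p y S).toFinset, fun F v => ?_⟩
  have h := (Pi.hasSum.mp (hasSum_field p r y F v)) S
  refine h.unique (hasSum_sum_of_ne_finset_zero fun k hk => ?_)
  have : psi (y + ((p : ℕ) : ℤ) * k) v S = 0 := by
    by_contra h
    exact hk ((finite_steps p y S).mem_toFinset.mpr (mem_occ_of_psi_ne_zero h))
  simp [this]

/-- Conjugation by the flow multiplies the power series of a field by
`exp ∑_m (1/m) t_m z^m = ∑_k h_k(t) z^k`. -/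
theorem Gam_mul_psi (p : ℕ+) (r : ℤ → ℂ) (t : ℕ → ℂ) (y : ℤ) :
    Gam p r t * psi y = field p r y (completeSeries t) * Gam p r t := by
  have hT := raises_generator (RelEmbedding.refl _) p r t
  refine opExp_mul_eq hT hT (X := fun l => field p r y (expTerm t l))
    (fun l => continuous_field ..) (fun w => ?_) (fun k => ?_) (fun v S => ?_)
  · refine Pi.hasSum.mpr fun S => ?_
    obtain ⟨s, hs⟩ := exists_field_apply p r y S
    simp only [hs]
    refine hasSum_sum fun k _ => ?_
    simp only [completeSeries, PowerSeries.coeff_mk, mul_assoc]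
    exact (hasSum_coeff_expTerm t k).mul_right _
  · have := divPow_mul_eq (generator (RelEmbedding.refl _) p r t) (field p r y) (expTerm t)
      (T' := generator (RelEmbedding.refl _) p r t) (fun l => ?_) k
    · rwa [show expTerm t 0 = 1 by simp [expTerm], field_one] at this
    · rw [mul_field_of_mul_psi (continuous_generator _ _ _ _) (generator_mul_psi p r t),
        expTerm_mul_exponent, field_smul]
  · obtain ⟨s, hs⟩ := exists_field_apply p r y S
    refine (s.finite_toSet.biUnion
      (t := fun k => {l : ℕ | l ≤ k} ×ˢ
        {m : ℕ | m ≤ (S.clear (y + ((p : ℕ) : ℤ) * k)).energy.toNat})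
      fun k _ => (Set.finite_le_nat _).prod (Set.finite_le_nat _)).subset ?_
    rintro ⟨l, m⟩ hx
    simp only [Set.mem_ofPred_eq, hs] at hx
    obtain ⟨k, hk, hne⟩ := Finset.exists_ne_zero_of_sum_ne_zero hx
    simp only [Set.mem_iUnion]
    refine ⟨k, hk, ?_, ?_⟩
    · by_contra h
      exact hne (by simp [coeff_expTerm_of_lt t (not_le.mp h)])
    · by_contra h
      refine hne ?_
      simp only [Set.mem_ofPred_eq, not_le] at h
      have hm : (S.clear (y + ((p : ℕ) : ℤ) * k)).energy < m := by omega
      simp [psi_apply, divPow_apply_eq_zero hT v hm]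

/-! ### Matrix elements of the flow as determinants -/

/-- The one-particle matrix element of the flow from the site `y` to the site `x`. -/
noncomputable def kernel (p : ℕ+) (r : ℤ → ℂ) (t : ℕ → ℂ) (x y : ℤ) : ℂ :=
  if ((p : ℕ) : ℤ) ∣ x - y ∧ y ≤ x then
    complete t ((x - y) / ((p : ℕ) : ℤ)) * weight p r y ((x - y) / ((p : ℕ) : ℤ)).toNat
  else 0

theorem kernel_add (p : ℕ+) (r : ℤ → ℂ) (t : ℕ → ℂ) (y : ℤ) (k : ℕ) :
    kernel p r t (y + ((p : ℕ) : ℤ) * k) y = complete t k * weight p r y k := by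
  have hp : (0 : ℤ) < ((p : ℕ) : ℤ) := by exact_mod_cast p.pos
  have h : (0 : ℤ) ≤ ((p : ℕ) : ℤ) * k := by positivity
  simp [kernel, Int.mul_ediv_cancel_left _ hp.ne', h]

theorem kernel_eq_zero {p : ℕ+} {r : ℤ → ℂ} {t : ℕ → ℂ} {x y : ℤ}
    (h : ∀ k : ℕ, x ≠ y + ((p : ℕ) : ℤ) * k) : kernel p r t x y = 0 := by
  have hp : (0 : ℤ) < ((p : ℕ) : ℤ) := by exact_mod_cast p.pos
  rw [kernel, if_neg]
  rintro ⟨⟨k, hk⟩, hxy⟩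
  have hk0 : 0 ≤ k := by
    by_contra hk0
    have := mul_neg_of_pos_of_neg hp (not_le.mp hk0)
    omega
  exact h k.toNat (by rw [Int.toNat_of_nonneg hk0]; omega)

/-- The coordinate `⟨S| · ` of a field only involves the occupied sites of `S`. -/
theorem field_apply_eq_sum (p : ℕ+) (r : ℤ → ℂ) (t : ℕ → ℂ) (y : ℤ) (w : Fock) {S : Maya}
    {s : Finset ℤ} (hs : ∀ i ∈ s, i ∈ S.occ) (hs' : ∀ i ∈ S.occ, y ≤ i → i ∈ s) :
    field p r y (completeSeries t) w S =
      ∑ i ∈ s, kernel p r t i y * (S.sgn i * w (S.clear i)) := by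
  have hp : (0 : ℤ) < ((p : ℕ) : ℤ) := by exact_mod_cast p.pos
  have h1 := (Pi.hasSum.mp (hasSum_field p r y (completeSeries t) w)) S
  have hinj : Function.Injective fun k : ℕ => y + ((p : ℕ) : ℤ) * k := by
    intro a b h
    have := mul_left_cancel₀ hp.ne' (add_left_cancel h)
    exact_mod_cast this
  have h2 : HasSum (fun i => kernel p r t i y * psi i w S)
      (∑ i ∈ s, kernel p r t i y * psi i w S) := by
    refine hasSum_sum_of_ne_finset_zero fun i hi => ?_
    by_cases hiS : i ∈ S.occ
    · have hiy : ¬ y ≤ i := fun h => hi (hs' i hiS h)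
      simp [kernel, hiy]
    · simp [psi_apply, hiS]
  rw [← hinj.hasSum_iff] at h2
  · have h3 := h1.unique (h2.congr_fun fun k => ?_)
    · rw [h3]
      exact Finset.sum_congr rfl fun i hi => by simp [psi_apply, hs i hi]
    · simp [kernel_add, completeSeries]
  · intro i hi
    rw [kernel_eq_zero fun k hk => hi ⟨k, hk.symm⟩, zero_mul]

/-- The Maya diagram in which the sites below `M` and the sites in `s` are occupied. -/
def Maya.sea (M : ℤ) (s : Finset ℤ) : Maya where
  occ := {i | i < M ∨ i ∈ s}
  particles_finite := ((Set.finite_Ico 0 M).union s.finite_toSet).subset (by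
    rintro x ⟨hx | hx, h0⟩
    · exact Or.inl ⟨h0, hx⟩
    · exact Or.inr hx)
  holes_finite := (Set.finite_Ico M 0).subset (by
    rintro x ⟨hx, h0⟩
    exact ⟨not_lt.mp fun h => hx (Or.inl h), h0⟩)

@[simp] theorem Maya.mem_sea {M : ℤ} {s : Finset ℤ} {i : ℤ} :
    i ∈ (Maya.sea M s).occ ↔ i < M ∨ i ∈ s := Iff.rfl

/-- Since `T` raises the energy, its powers have no diagonal matrix elements. -/
theorem divPow_ket_self {T : Module.End ℂ Fock} (hT : Raises T) (S : Maya) (k : ℕ) :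
    divPow T (k + 1) (ket S) S = 0 := by
  have key : ∀ (j : ℕ) (S' : Maya), S'.energy < S.energy + j → (T ^ j) (ket S) S' = 0 := by
    intro j
    induction j with
    | zero =>
      intro S' h
      have : S' ≠ S := by
        rintro rfl
        simp at h
      simp [ket, this]
    | succ j ih =>
      intro S' h
      rw [pow_succ', Module.End.mul_apply]
      exact hT _ _ fun S'' h' => ih S'' (by push_cast at h; omega)
  simp [divPow, key (k + 1) S (by push_cast; omega)]

theorem matrixElement_opExp_self {T : Module.End ℂ Fock} (hT : Raises T) (S : Maya) :
    matrixElement S (opExp T hT) S = 1 := by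
  have h := (Pi.hasSum.mp (hasSum_opExp hT (ket S))) S
  refine h.unique ((hasSum_ite_eq (0 : ℕ) (1 : ℂ)).congr_fun fun k => ?_)
  rcases k with _ | k
  · simp [ket]
  · simp [divPow_ket_self hT]

theorem Maya.sgn_sea_image {n : ℕ} {M : ℤ} {x : Fin n → ℤ} (hx : StrictAnti x) (hM : ∀ i, M ≤ x i)
    (k : Fin n) : (Maya.sea M (Finset.univ.image x)).sgn (x k) = (-1) ^ (k : ℕ) := by
  have e : {s | s ∈ (Maya.sea M (Finset.univ.image x)).occ ∧ x k < s} =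
      ((Finset.univ.filter (· < k)).image x : Finset ℤ) := by
    ext s
    simp only [Maya.mem_sea, Finset.mem_image, Finset.mem_univ, true_and, Set.mem_ofPred_eq,
      Finset.coe_image, Finset.coe_filter, Set.mem_image]
    constructor
    · rintro ⟨h | ⟨i, rfl⟩, h'⟩
      · have := hM k
        omega
      · exact ⟨i, hx.lt_iff_gt.mp h', rfl⟩
    · rintro ⟨i, hi, rfl⟩
      exact ⟨Or.inr ⟨i, rfl⟩, hx hi⟩
  rw [Maya.sgn, e, Set.ncard_coe_finset, Finset.card_image_of_injective _ hx.injective]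
  congr 1
  rw [← Fin.card_Iio k]
  congr 1
  ext i
  simp

/-- Matrix elements of the flow between states with `n` particles above a common sea: expanding
`Γ ψ_{y_0} = (∑_i K(i, y_0) ψ_i) Γ` is the Laplace expansion along the column of `y_0`. -/
theorem matrixElement_sea (p : ℕ+) (r : ℤ → ℂ) (t : ℕ → ℂ) (M : ℤ) (n : ℕ) :
    ∀ x y : Fin n → ℤ, StrictAnti x → StrictAnti y → (∀ i, M ≤ x i) → (∀ i, M ≤ y i) →
      matrixElement (Maya.sea M (Finset.univ.image x)) (Gam p r t)
        (Maya.sea M (Finset.univ.image y)) =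
      (Matrix.of fun i j => kernel p r t (x i) (y j)).det := by
  induction n with
  | zero =>
    intro x y _ _ _ _
    rw [Matrix.det_isEmpty]
    obtain rfl := Subsingleton.elim x y
    exact matrixElement_opExp_self (raises_generator (RelEmbedding.refl _) p r t) _
  | succ n ih =>
    intro x y hx hy hMx hMy
    set y' : Fin n → ℤ := fun j => y j.succ with hy'
    have hfill : (Maya.sea M (Finset.univ.image y')).fill (y 0) =
        Maya.sea M (Finset.univ.image y) := by
      ext s
      simp only [Maya.mem_fill, Maya.mem_sea, Finset.mem_image, Finset.mem_univ, true_and,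
        Fin.exists_fin_succ, hy']
      tauto
    have hnot : y 0 ∉ (Maya.sea M (Finset.univ.image y')).occ := by
      simp only [Maya.mem_sea, Finset.mem_image, Finset.mem_univ, true_and, not_or, not_lt,
        not_exists]
      exact ⟨hMy 0, fun j => (hy (Fin.succ_pos j)).ne⟩
    have hket : ket (Maya.sea M (Finset.univ.image y)) =
        psi (y 0) (ket (Maya.sea M (Finset.univ.image y'))) := by
      have h1 := Maya.sgn_sea_image hy hMy 0
      rw [← hfill, Maya.sgn_fill hnot] at h1
      simp only [lt_irrefl, if_false, one_mul, Fin.val_zero, pow_zero] at h1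
      rw [ket_fill hnot, hfill, h1, one_smul]
    have hG := LinearMap.congr_fun (Gam_mul_psi p r t (y 0))
      (ket (Maya.sea M (Finset.univ.image y')))
    simp only [Module.End.mul_apply] at hG
    rw [matrixElement, hket, hG, field_apply_eq_sum p r t (y 0) _ (s := Finset.univ.image x)
      (fun i hi => Maya.mem_sea.mpr (Or.inr hi)) (fun i hi hyi => ?_),
      Finset.sum_image hx.injective.injOn, Matrix.det_succ_column_zero]
    · refine Finset.sum_congr rfl fun k _ => ?_
      have hclear : (Maya.sea M (Finset.univ.image x)).clear (x k) =
          Maya.sea M (Finset.univ.image fun i => x (k.succAbove i)) := by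
        ext s
        simp only [Maya.mem_clear, Maya.mem_sea, Finset.mem_image, Finset.mem_univ, true_and]
        constructor
        · rintro ⟨h | ⟨i, rfl⟩, hne⟩
          · exact Or.inl h
          · obtain ⟨j, rfl⟩ := Fin.exists_succAbove_eq (x := i) (y := k) (fun h => hne (by rw [h]))
            exact Or.inr ⟨j, rfl⟩
        · rintro (h | ⟨i, rfl⟩)
          · exact ⟨Or.inl h, fun h' => by have := hMx k; omega⟩
          · exact ⟨Or.inr ⟨_, rfl⟩, fun h' => Fin.succAbove_ne k i (hx.injective h')⟩
      have := ih (fun i => x (k.succAbove i)) y' (hx.comp_strictMono (Fin.strictMono_succAbove k))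
        (hy.comp_strictMono Fin.strictMono_succ) (fun _ => hMx _) (fun _ => hMy _)
      rw [matrixElement] at this
      rw [hclear, this, Maya.sgn_sea_image hx hMx]
      simp only [Matrix.of_apply]
      rw [mul_left_comm, mul_assoc]
      rfl
    · rcases hi with hi | hi
      · have := hMy 0
        have : i < M := hi
        omega
      · exact hi

theorem mayaOf_eq_sea (la : YoungDiagram) {N : ℕ} (hN : la.colLen 0 ≤ N) :
    mayaOf la = Maya.sea (-(N : ℤ)) (Finset.univ.image fun i : Fin N => coord la i) := by
  ext s
  simp only [mayaOf, Maya.mem_sea, Finset.mem_image, Finset.mem_univ, true_and, Set.mem_range]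
  constructor
  · rintro ⟨i, rfl⟩
    rcases lt_or_ge i N with h | h
    · exact Or.inr ⟨⟨i, h⟩, rfl⟩
    · left
      rw [coord_of_le la (hN.trans h)]
      omega
  · rintro (h | ⟨i, rfl⟩)
    · refine ⟨(-s - 1).toNat, ?_⟩
      rw [coord_of_le la (by omega)]
      omega
    · exact ⟨i, rfl⟩

theorem neg_le_coord (la : YoungDiagram) {N i : ℕ} (h : i < N) : -(N : ℤ) ≤ coord la i := by
  unfold coord
  omega

theorem matrixElement_Gam (p : ℕ+) (r : ℤ → ℂ) (t : ℕ → ℂ) {la mu : YoungDiagram} {N : ℕ}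
    (hla : la.colLen 0 ≤ N) (hmu : mu.colLen 0 ≤ N) :
    matrixElement (mayaOf la) (Gam p r t) (mayaOf mu) =
      (Matrix.of fun i j : Fin N => kernel p r t (coord la i) (coord mu j)).det := by
  rw [mayaOf_eq_sea la hla, mayaOf_eq_sea mu hmu]
  exact matrixElement_sea p r t _ N _ _ (fun i j h => coord_strictAnti la h)
    (fun i j h => coord_strictAnti mu h) (fun i => neg_le_coord la i.2)
    (fun i => neg_le_coord mu i.2)

/-! ### Determinants split by colour -/

theorem sort_symm_lt_iff {n : ℕ} {α : Type*} [LinearOrder α] (f : Fin n → α) {i j : Fin n}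
    (hij : i < j) : (Tuple.sort f)⁻¹ i < (Tuple.sort f)⁻¹ j ↔ ¬ f j < f i := by
  obtain ⟨hmono, hstable⟩ := (Tuple.eq_sort_iff (σ := Tuple.sort f) (f := f)).mp rfl
  set σ := Tuple.sort f with hσ
  have hi : σ (σ⁻¹ i) = i := σ.apply_symm_apply i
  have hj : σ (σ⁻¹ j) = j := σ.apply_symm_apply j
  constructor
  · intro h
    have := hmono h.le
    simp only [Function.comp_apply, hi, hj] at this
    exact this.not_gt
  · intro h
    by_contra hlt
    have hne : σ⁻¹ j ≠ σ⁻¹ i := fun h' => hij.ne (σ⁻¹.injective h').symm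
    have hlt' : σ⁻¹ j < σ⁻¹ i := lt_of_le_of_ne (not_lt.mp hlt) hne
    have h1 := hmono hlt'.le
    simp only [Function.comp_apply, hi, hj] at h1
    have h2 := hstable _ _ hlt' (by rw [hi, hj]; exact le_antisymm h1 (not_lt.mp h))
    rw [hi, hj] at h2
    exact hij.asymm h2

/-- The stable sorting permutation has the sign given by the number of inversions. -/
theorem sign_sort {n : ℕ} {α : Type*} [LinearOrder α] (f : Fin n → α) :
    (((Equiv.Perm.sign (Tuple.sort f) : ℤˣ) : ℤ) : ℂ) =
      (-1) ^ (Finset.univ.filter fun ij : Fin n × Fin n => ij.1 < ij.2 ∧ f ij.2 < f ij.1).card := by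
  rw [← Equiv.Perm.sign_inv, Equiv.Perm.sign_eq_prod_prod_Ioi]
  rw [← Finset.prod_const, Finset.prod_filter, ← Finset.univ_product_univ, Finset.prod_product]
  push_cast
  refine Finset.prod_congr rfl fun i _ => ?_
  rw [← Finset.filter_lt_eq_Ioi, Finset.prod_filter]
  refine Finset.prod_congr rfl fun j _ => ?_
  by_cases hij : i < j
  · simp only [hij, if_true, true_and, sort_symm_lt_iff f hij]
    split_ifs <;> simp_all
  · simp [hij]

/-- If the nonzero entries of `M` match the row labels `f` with the column labels `g`, then a nonzero
term of the determinant comes from a bijection that preserves labels. -/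
theorem det_eq_zero_of_card_ne {ι α : Type*} [Fintype ι] [DecidableEq ι] [DecidableEq α]
    {f g : ι → α} {M : Matrix ι ι ℂ} (hM : ∀ i j, f i ≠ g j → M i j = 0) {c : α}
    (h : (Finset.univ.filter fun i => f i = c).card ≠ (Finset.univ.filter fun j => g j = c).card) :
    M.det = 0 := by
  rw [Matrix.det_apply]
  refine Finset.sum_eq_zero fun σ _ => ?_
  obtain ⟨j, hj⟩ : ∃ j, f (σ j) ≠ g j := by
    by_contra hall
    push Not at hall
    refine h (Finset.card_bij (fun i _ => σ.symm i) ?_ ?_ ?_)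
    · intro i hi
      have := hall (σ.symm i)
      simp_all
    · intro i _ i' _ h'
      exact σ.symm.injective h'
    · intro j hj
      exact ⟨σ j, by simpa [hall] using hj, by simp⟩
  have h0 : ∏ i, M (σ i) i = 0 := Finset.prod_eq_zero (Finset.mem_univ j) (hM _ _ hj)
  rw [h0, smul_zero]

/-- If the matrix `K(x_i, y_j)` only couples sites of the same colour, and every colour occurs
equally often among the `x_i` as among the `y_j`, then sorting rows and columns by colour makes the
matrix block diagonal. -/
theorem det_eq_sign_mul_prod_det {N : ℕ} {α : Type*} [LinearOrder α] [Fintype α] {K : ℤ → ℤ → ℂ}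
    {col : ℤ → α} (hK : ∀ x y, col x ≠ col y → K x y = 0) {x y : Fin N → ℤ} (hx : StrictAnti x)
    (hy : StrictAnti y) {n : α → ℕ}
    (hnx : ∀ c, (Finset.univ.filter fun i => col (x i) = c).card = n c)
    (hny : ∀ c, (Finset.univ.filter fun i => col (y i) = c).card = n c)
    {u v : (c : α) → Fin (n c) → ℤ} (hu : ∀ c, StrictAnti (u c)) (hv : ∀ c, StrictAnti (v c))
    (hur : ∀ c z, z ∈ Set.range (u c) ↔ z ∈ Set.range x ∧ col z = c)
    (hvr : ∀ c z, z ∈ Set.range (v c) ↔ z ∈ Set.range y ∧ col z = c) :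
    (Matrix.of fun i j => K (x i) (y j)).det =
      ((Equiv.Perm.sign (Tuple.sort (col ∘ x)) : ℤˣ) : ℤ) *
        ((Equiv.Perm.sign (Tuple.sort (col ∘ y)) : ℤˣ) : ℤ) *
        ∏ c, (Matrix.of fun i j => K (u c i) (v c j)).det := by
  classical
  set σ := Tuple.sort (col ∘ x) with hσ
  set τ := Tuple.sort (col ∘ y) with hτ
  obtain ⟨hσm, hσs⟩ := Tuple.eq_sort_iff.mp hσ
  obtain ⟨hτm, hτs⟩ := Tuple.eq_sort_iff.mp hτ
  -- Both sorted sequences of colours agree, since each is determined by the multiplicities.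
  have hb : (col ∘ x) ∘ σ = (col ∘ y) ∘ τ := by
    have e : ∀ c, Nonempty ({i // (col ∘ x) i = c} ≃ {i // (col ∘ y) i = c}) := fun c =>
      Fintype.card_eq.mp (by
        rw [Fintype.card_subtype, Fintype.card_subtype]
        exact (hnx c).trans (hny c).symm)
    let π : Equiv.Perm (Fin N) := Equiv.ofFiberEquiv fun c => (e c).some
    have hπ : (col ∘ y) ∘ π = col ∘ x := funext fun i => Equiv.ofFiberEquiv_map _ i
    have h1 : (col ∘ x) ∘ σ = (col ∘ y) ∘ (σ.trans π : Equiv.Perm (Fin N)) := by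
      rw [← hπ]; rfl
    rw [h1]
    rw [h1] at hσm
    exact Tuple.unique_monotone hσm hτm
  set M := Matrix.of fun i j => K (x i) (y j) with hM
  set b : Fin N → α := (col ∘ x) ∘ σ with hbdef
  have hdet : (M.submatrix σ τ).det =
      ((Equiv.Perm.sign σ : ℤˣ) : ℤ) * (((Equiv.Perm.sign τ : ℤˣ) : ℤ) * M.det) := by
    have h1 : M.submatrix σ τ = (M.submatrix id τ).submatrix σ id := rfl
    rw [h1, Matrix.det_permute, Matrix.det_permute']
  have hsq : ∀ ρ : Equiv.Perm (Fin N),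
      (((Equiv.Perm.sign ρ : ℤˣ) : ℤ) : ℂ) * ((Equiv.Perm.sign ρ : ℤˣ) : ℤ) = 1 := by
    intro ρ
    rw [← Int.cast_mul, ← Units.val_mul, Int.units_mul_self]
    simp
  have hdet' : M.det = ((Equiv.Perm.sign σ : ℤˣ) : ℤ) * ((Equiv.Perm.sign τ : ℤˣ) : ℤ) *
      (M.submatrix σ τ).det := by
    rw [hdet]
    linear_combination (-M.det) * ((((Equiv.Perm.sign τ : ℤˣ) : ℤ) : ℂ) *
      ((Equiv.Perm.sign τ : ℤˣ) : ℤ)) * hsq σ - M.det * hsq τ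
  have htri : (M.submatrix σ τ).BlockTriangular b := by
    intro i j hij
    refine hK _ _ ?_
    have : col (y (τ j)) = b j := (congrFun hb j).symm
    rw [this]
    exact hij.ne'
  rw [hdet', htri.det_fintype]
  congr 1
  refine Finset.prod_congr rfl fun c _ => ?_
  -- The block of colour `c`, re-indexed increasingly.
  have hcard : Fintype.card {k // b k = c} = n c := by
    rw [← hnx c, Fintype.card_subtype]
    refine Finset.card_bij (fun k _ => σ k) ?_ ?_ ?_
    · intro k hk
      simpa [hbdef] using hk
    · intro k _ k' _ h
      exact σ.injective h
    · intro i hi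
      exact ⟨σ⁻¹ i, by simpa [hbdef] using hi, by simp⟩
  let e : Fin (n c) ≃o {k // b k = c} := monoEquivOfFin _ hcard
  have hux : (fun i => x (σ (e i))) = u c := by
    refine (StrictAnti.range_inj ?_ (hu c)).mp ?_
    · intro i j hij
      refine hx (hσs _ _ (e.strictMono hij) ?_)
      exact (e i).2.trans (e j).2.symm
    · ext z
      rw [hur]
      constructor
      · rintro ⟨i, rfl⟩
        exact ⟨⟨_, rfl⟩, (e i).2⟩
      · rintro ⟨⟨i, rfl⟩, hc⟩
        exact ⟨e.symm ⟨σ⁻¹ i, by simpa [hbdef] using hc⟩, by simp⟩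
  have hvy : (fun i => y (τ (e i))) = v c := by
    have hby : ∀ k, b k = col (y (τ k)) := fun k => congrFun hb k
    refine (StrictAnti.range_inj ?_ (hv c)).mp ?_
    · intro i j hij
      refine hy (hτs _ _ (e.strictMono hij) ?_)
      exact ((hby _).symm.trans (e i).2).trans ((e j).2.symm.trans (hby _))
    · ext z
      rw [hvr]
      constructor
      · rintro ⟨i, rfl⟩
        exact ⟨⟨_, rfl⟩, (hby _).symm.trans (e i).2⟩
      · rintro ⟨⟨i, rfl⟩, hc⟩
        exact ⟨e.symm ⟨τ⁻¹ i, by rw [hby]; simpa using hc⟩, by simp⟩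
  rw [← Matrix.det_submatrix_equiv_self e.toEquiv]
  congr 1
  ext i j
  have h1 := congrFun hux i
  have h2 := congrFun hvy j
  change K (x (σ (e i))) (y (τ (e j))) = K (u c i) (v c j)
  rw [← h1, ← h2]

/-! ### Factoring out content products -/

/-- For a permutation `σ` with `y_j ≤ x_{σ j}` for all `j`, the intervals `(y_j, x_{σ j}]` cover
every site as often as the intervals `(y_j, x_j]`. -/
theorem prod_Ioc_perm {n : ℕ} {x y : Fin n → ℤ} (hx : StrictAnti x) (hy : StrictAnti y)
    (r : ℤ → ℂ) (σ : Equiv.Perm (Fin n)) (h : ∀ j, y j ≤ x (σ j)) :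
    ∏ j, ∏ m ∈ Finset.Ioc (y j) (x (σ j)), r m = ∏ j, ∏ m ∈ Finset.Ioc (y j) (x j), r m := by
  -- If `x k < y k`, then `σ` would map `{0, …, k}` injectively into `{0, …, k - 1}`.
  have hle : ∀ k, y k ≤ x k := by
    intro k
    by_contra hk
    have hmaps : ∀ j ∈ Finset.Iic k, σ j ∈ Finset.Iio k := by
      intro j hj
      rw [Finset.mem_Iic] at hj
      rw [Finset.mem_Iio]
      have h1 := hy.antitone hj
      have h2 := h j
      exact hx.lt_iff_gt.mp (by omega)
    have := Finset.card_le_card_of_injOn σ hmaps σ.injective.injOn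
    simp at this
  obtain ⟨B, hB⟩ : ∃ B, ∀ j, B ≤ y j := by
    obtain ⟨B, hB⟩ := (Set.finite_range y).bddBelow
    exact ⟨B, fun j => hB ⟨j, rfl⟩⟩
  have hsplit : ∀ {b c : ℤ}, B ≤ b → b ≤ c →
      (Finset.Ioc B b).val + (Finset.Ioc b c).val = (Finset.Ioc B c).val := by
    intro b c h1 h2
    have hd : Disjoint (Finset.Ioc B b) (Finset.Ioc b c) := by
      rw [Finset.disjoint_left]
      intro z hz hz'
      simp only [Finset.mem_Ioc] at hz hz'
      omega
    have := congrArg Finset.val (Finset.disjUnion_eq_union _ _ hd)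
    rw [Finset.Ioc_union_Ioc_eq_Ioc h1 h2] at this
    exact this
  -- The factors `r m` may vanish, so the cancellation is done for multisets of sites: adding the
  -- intervals `(B, y_j]` to either side gives the intervals `(B, x_j]`, in some order.
  have hms : ∑ j, (Finset.Ioc (y j) (x (σ j))).val = ∑ j, (Finset.Ioc (y j) (x j)).val := by
    refine add_left_cancel (a := ∑ j, (Finset.Ioc B (y j)).val) ?_
    rw [← Finset.sum_add_distrib, ← Finset.sum_add_distrib]
    simp only [hsplit (hB _) (h _), hsplit (hB _) (hle _)]
    exact Equiv.sum_comp σ fun j => (Finset.Ioc B (x j)).val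
  have hprod : ∀ s : Fin n → Multiset ℤ, ((∑ j, s j).map r).prod = ∏ j, ((s j).map r).prod := by
    intro s
    rw [← Multiset.coe_mapAddMonoidHom, map_sum, Multiset.prod_sum]
  have := congrArg (fun s : Multiset ℤ => (s.map r).prod) hms
  simp only [hprod] at this
  exact this

/-- The products over intervals factor out of the determinant, as they contribute the same to every
nonzero term. -/
theorem det_mul_prod_Ioc {n : ℕ} {x y : Fin n → ℤ} (hx : StrictAnti x) (hy : StrictAnti y)
    (r : ℤ → ℂ) {h : ℤ → ℂ} (hh : ∀ d, d < 0 → h d = 0) :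
    (Matrix.of fun i j => h (x i - y j) * ∏ m ∈ Finset.Ioc (y j) (x i), r m).det =
      (∏ i, ∏ m ∈ Finset.Ioc (y i) (x i), r m) * (Matrix.of fun i j => h (x i - y j)).det := by
  rw [Matrix.det_apply, Matrix.det_apply, Finset.mul_sum]
  refine Finset.sum_congr rfl fun σ _ => ?_
  simp only [Matrix.of_apply, mul_smul_comm]
  congr 1
  rw [Finset.prod_mul_distrib, mul_comm]
  by_cases hσ : ∀ j, y j ≤ x (σ j)
  · rw [prod_Ioc_perm hx hy r σ hσ]
  · push Not at hσ
    obtain ⟨j, hj⟩ := hσ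
    have h0 : ∏ i, h (x (σ i) - y i) = 0 :=
      Finset.prod_eq_zero (Finset.mem_univ j) (hh _ (by omega))
    rw [h0, mul_zero, mul_zero]

/-! ### Skew Schur functions -/

theorem complete_of_neg (t : ℕ → ℂ) {k : ℤ} (hk : k < 0) : complete t k = 0 := if_pos hk

theorem complete_zero (t : ℕ → ℂ) : complete t 0 = 1 := by
  refine (hasSum_coeff_expTerm t 0).unique ((hasSum_ite_eq (0 : ℕ) (1 : ℂ)).congr_fun fun l => ?_)
  rcases l with _ | l
  · simp [expTerm]
  · simpa using coeff_expTerm_of_lt t l.succ_pos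

/-- Stretching the times substitutes `z ^ p` for `z`. -/
theorem exponent_stretch (p : ℕ+) (t : ℕ → ℂ) :
    exponent (stretch p t) = PowerSeries.expand p p.ne_zero (exponent t) := by
  ext m
  rw [PowerSeries.coeff_expand]
  simp only [exponent, PowerSeries.coeff_mk, stretch]
  split_ifs with h
  · obtain ⟨k, rfl⟩ := h
    have hp : ((p : ℕ) : ℂ) ≠ 0 := by exact_mod_cast p.ne_zero
    rw [Nat.mul_div_cancel_left _ p.pos, Nat.cast_mul, mul_div_mul_left _ _ hp]
  · simp

theorem complete_natCast (t : ℕ → ℂ) (k : ℕ) :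
    complete t k = coeff k ((PowerSeries.exp ℂ).subst (exponent t)) := by
  simp [complete, exponent]

theorem complete_stretch_natCast (p : ℕ+) (t : ℕ → ℂ) (m : ℕ) :
    complete (stretch p t) m = if (p : ℕ) ∣ m then complete t (m / (p : ℕ) : ℕ) else 0 := by
  rw [complete_natCast, exponent_stretch, PowerSeries.expand_apply,
    ← PowerSeries.subst_comp_subst_apply (hasSubst_exponent t) (HasSubst.X_pow p.ne_zero),
    ← PowerSeries.expand_apply p p.ne_zero, PowerSeries.coeff_expand]
  simp only [complete_natCast]

theorem complete_stretch_mul (p : ℕ+) (t : ℕ → ℂ) (k : ℤ) :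
    complete (stretch p t) (((p : ℕ) : ℤ) * k) = complete t k := by
  have hp : (0 : ℤ) < ((p : ℕ) : ℤ) := by exact_mod_cast p.pos
  rcases lt_or_ge k 0 with hk | hk
  · rw [complete_of_neg _ hk, complete_of_neg _ (mul_neg_of_pos_of_neg hp hk)]
  · lift k to ℕ using hk
    have := complete_stretch_natCast p t ((p : ℕ) * k)
    simpa [Nat.mul_div_cancel_left _ p.pos] using this

theorem complete_stretch_of_not_dvd (p : ℕ+) (t : ℕ → ℂ) {k : ℤ} (h : ¬ ((p : ℕ) : ℤ) ∣ k) :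
    complete (stretch p t) k = 0 := by
  rcases lt_or_ge k 0 with hk | hk
  · exact complete_of_neg _ hk
  · lift k to ℕ using hk
    rw [complete_stretch_natCast, if_neg (by exact_mod_cast h)]

/-- The determinant of `h_{x_i - y_j}` does not change when rows in which `x` and `y` agree are
appended. -/
theorem det_complete_of_le (t : ℕ → ℂ) {x y : ℕ → ℤ} (hy : StrictAnti y) {n N : ℕ} (hnN : n ≤ N)
    (h : ∀ i, n ≤ i → x i = y i) :
    (Matrix.of fun i j : Fin N => complete t (x i - y j)).det =
      (Matrix.of fun i j : Fin n => complete t (x i - y j)).det := by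
  induction N, hnN using Nat.le_induction with
  | base => rfl
  | succ N hN ih =>
    rw [Matrix.det_succ_row _ (Fin.last N), Finset.sum_eq_single_of_mem (Fin.last N)
      (Finset.mem_univ _), ← ih]
    · simp only [Matrix.of_apply, Fin.val_last, h N hN, sub_self, complete_zero, mul_one,
        ← two_mul, pow_mul, Fin.succAbove_last]
      simp only [even_two, Even.neg_pow, one_pow, one_mul]
      rfl
    · intro j _ hj
      have hlt : (j : ℕ) < N := Fin.val_lt_last hj
      have h1 := hy hlt
      simp only [Matrix.of_apply, Fin.val_last, h N hN]
      rw [complete_of_neg _ (by omega)]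
      simp

theorem skewSchur_eq_det (t : ℕ → ℂ) {x y a b : ℕ → ℤ} (hy : StrictAnti y)
    (ha : ∀ i : ℕ, a i = x i + ((i : ℤ) + 1)) (hb : ∀ i : ℕ, b i = y i + ((i : ℤ) + 1)) {N : ℕ}
    (h : ∀ i, N ≤ i → x i = y i) :
    skewSchur t a b = (Matrix.of fun i j : Fin N => complete t (x i - y j)).det := by
  classical
  have hab : ∀ i, a i = b i ↔ x i = y i := fun i => by
    rw [ha, hb]
    constructor <;> intro h <;> omega
  have hex : ∃ N : ℕ, ∀ i, N ≤ i → a i = b i := ⟨N, fun i hi => (hab i).mpr (h i hi)⟩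
  rw [skewSchur, dif_pos hex, det_complete_of_le t hy (n := Nat.find hex)
    (Nat.find_min' hex fun i hi => (hab i).mpr (h i hi))
    (fun i hi => (hab i).mp (Nat.find_spec hex i hi))]
  congr 1
  ext i j
  simp only [Matrix.of_apply, ha, hb]
  congr 1
  ring

theorem contentProd_eq_prod (r : ℤ → ℂ) {x y a b : ℕ → ℤ}
    (ha : ∀ i : ℕ, a i = x i + ((i : ℤ) + 1)) (hb : ∀ i : ℕ, b i = y i + ((i : ℤ) + 1)) {N : ℕ}
    (h : ∀ i, N ≤ i → x i = y i) :
    contentProd r a b = ∏ i : Fin N, ∏ m ∈ Finset.Ioc (y i) (x i), r m := by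
  have hrow : ∀ i : ℕ, ∏ j ∈ Finset.Ioc (b i) (a i), r (j - ((i : ℤ) + 1)) =
      ∏ m ∈ Finset.Ioc (y i) (x i), r m := by
    intro i
    refine Finset.prod_nbij' (fun j => j - ((i : ℤ) + 1)) (fun m => m + ((i : ℤ) + 1))
      ?_ ?_ ?_ ?_ ?_
    · intro j hj
      rw [Finset.mem_Ioc, ha, hb] at hj
      rw [Finset.mem_Ioc]
      omega
    · intro m hm
      rw [Finset.mem_Ioc] at hm
      rw [Finset.mem_Ioc, ha, hb]
      omega
    · intro j _; ring
    · intro m _; ring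
    · intro j _; rfl
  unfold contentProd
  simp only [hrow]
  rw [finprod_eq_prod_of_mulSupport_subset (s := Finset.range N), Finset.prod_range]
  intro i hi
  by_contra hN
  refine hi ?_
  have hN' : N ≤ i := by simpa using hN
  simp [h i hN']

/-- `r_{a/b} s_{a/b}` as a single determinant. -/
theorem contentProd_mul_skewSchur (r : ℤ → ℂ) (t : ℕ → ℂ) {x y a b : ℕ → ℤ} (hx : StrictAnti x)
    (hy : StrictAnti y) (ha : ∀ i : ℕ, a i = x i + ((i : ℤ) + 1))
    (hb : ∀ i : ℕ, b i = y i + ((i : ℤ) + 1)) {N : ℕ} (h : ∀ i, N ≤ i → x i = y i) :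
    contentProd r a b * skewSchur t a b = (Matrix.of fun i j : Fin N =>
      complete t (x i - y j) * ∏ m ∈ Finset.Ioc (y j) (x i), r m).det := by
  rw [contentProd_eq_prod r ha hb h, skewSchur_eq_det t hy ha hb h]
  exact (det_mul_prod_Ioc (x := fun i : Fin N => x i) (y := fun i : Fin N => y i)
    (fun i j hij => hx hij) (fun i j hij => hy hij) r (fun d hd => complete_of_neg t hd)).symm

/-! ### Decreasing enumerations -/

theorem enumDown_eq {X : Set ℤ} {f : ℕ → ℤ} (hf : StrictAnti f) (hX : Set.range f = X) :
    enumDown X = f := by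
  subst hX
  funext i
  induction i with
  | zero =>
    refine IsGreatest.csSup_eq ⟨⟨0, rfl⟩, ?_⟩
    rintro _ ⟨j, rfl⟩
    exact hf.antitone (Nat.zero_le j)
  | succ i ih =>
    refine IsGreatest.csSup_eq ⟨⟨⟨i + 1, rfl⟩, ?_⟩, ?_⟩
    · rw [ih]
      exact hf i.lt_succ_self
    · rintro _ ⟨⟨j, rfl⟩, hj⟩
      rw [ih] at hj
      exact hf.antitone (hf.lt_iff_gt.mp hj)

theorem enumDown_zero_isGreatest {X : Set ℤ} (hb : BddAbove X) (hu : ∀ a, ∃ x ∈ X, x < a) :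
    IsGreatest X (enumDown X 0) := by
  obtain ⟨x, hx, -⟩ := hu 0
  exact ⟨Int.csSup_mem ⟨x, hx⟩ hb, fun z hz => le_csSup hb hz⟩

theorem enumDown_succ_isGreatest {X : Set ℤ} (hb : BddAbove X) (hu : ∀ a, ∃ x ∈ X, x < a) (i : ℕ) :
    IsGreatest {x | x ∈ X ∧ x < enumDown X i} (enumDown X (i + 1)) := by
  obtain ⟨x, hx⟩ := hu (enumDown X i)
  have hb' : BddAbove {x | x ∈ X ∧ x < enumDown X i} := hb.mono fun x hx => hx.1
  exact ⟨Int.csSup_mem ⟨x, hx⟩ hb', fun z hz => le_csSup hb' hz⟩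

theorem enumDown_strictAnti {X : Set ℤ} (hb : BddAbove X) (hu : ∀ a, ∃ x ∈ X, x < a) :
    StrictAnti (enumDown X) :=
  strictAnti_nat_of_succ_lt fun i => (enumDown_succ_isGreatest hb hu i).1.2

theorem range_enumDown {X : Set ℤ} (hb : BddAbove X) (hu : ∀ a, ∃ x ∈ X, x < a) :
    Set.range (enumDown X) = X := by
  classical
  ext x
  constructor
  · rintro ⟨i, rfl⟩
    rcases i with _ | i
    · exact (enumDown_zero_isGreatest hb hu).1
    · exact (enumDown_succ_isGreatest hb hu i).1.1
  · intro hx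
    have hex : ∃ i, enumDown X i ≤ x := by
      have hle : ∀ i : ℕ, enumDown X i ≤ enumDown X 0 - i := by
        intro i
        induction i with
        | zero => simp
        | succ i ih =>
          have := enumDown_strictAnti hb hu (Nat.lt_add_one i)
          push_cast
          omega
      refine ⟨(enumDown X 0 - x).toNat, ?_⟩
      have := hle (enumDown X 0 - x).toNat
      omega
    refine ⟨Nat.find hex, le_antisymm (Nat.find_spec hex) ?_⟩
    rcases hi : Nat.find hex with _ | i
    · exact (enumDown_zero_isGreatest hb hu).2 hx
    · refine (enumDown_succ_isGreatest hb hu i).2 ⟨hx, ?_⟩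
      exact not_le.mp (Nat.find_min hex (m := i) (by omega))

/-! ### Colours of particles -/

/-- The colour of the site `x`, i.e. its residue modulo `p`. -/
def residue (p : ℕ+) (x : ℤ) : Fin p :=
  ⟨(x % ((p : ℕ) : ℤ)).toNat, by
    have hp : (0 : ℤ) < ((p : ℕ) : ℤ) := by exact_mod_cast p.pos
    have := Int.emod_nonneg x hp.ne'
    have := Int.emod_lt_of_pos x hp
    omega⟩

theorem residue_val (p : ℕ+) (x : ℤ) : ((residue p x : ℕ) : ℤ) = x % ((p : ℕ) : ℤ) := by
  have hp : (0 : ℤ) < ((p : ℕ) : ℤ) := by exact_mod_cast p.pos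
  exact Int.toNat_of_nonneg (Int.emod_nonneg x hp.ne')

theorem residue_lt_iff (p : ℕ+) (x y : ℤ) :
    residue p x < residue p y ↔ x % ((p : ℕ) : ℤ) < y % ((p : ℕ) : ℤ) := by
  rw [← residue_val, ← residue_val, Fin.lt_def, Nat.cast_lt]

theorem mul_ediv_add_residue (p : ℕ+) (x : ℤ) :
    ((p : ℕ) : ℤ) * (x / ((p : ℕ) : ℤ)) + (residue p x : ℕ) = x := by
  rw [residue_val]
  exact Int.mul_ediv_add_emod x _

theorem residue_mul_add (p : ℕ+) (c : Fin p) (z : ℤ) :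
    residue p (((p : ℕ) : ℤ) * z + (c : ℕ)) = c :=
  (mul_add_inj (mul_ediv_add_residue p (((p : ℕ) : ℤ) * z + (c : ℕ)))).1

theorem residue_eq_of_dvd {p : ℕ+} {x y : ℤ} (h : ((p : ℕ) : ℤ) ∣ x - y) :
    residue p x = residue p y := by
  have h1 : x % ((p : ℕ) : ℤ) = y % ((p : ℕ) : ℤ) := (Int.modEq_iff_dvd.mpr h).symm
  exact Fin.ext (by simp [residue, h1])

/-- The positions `x^{(c)}_1 > x^{(c)}_2 > ⋯` of the particles of colour `c` of `λ`. -/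
noncomputable def colourCoord (p : ℕ+) (c : Fin p) (la : YoungDiagram) : ℕ → ℤ :=
  enumDown {x | ((p : ℕ) : ℤ) * x + (c : ℕ) ∈ (mayaOf la).occ}

theorem mem_mayaOf_iff (la : YoungDiagram) {N : ℕ} (hN : la.colLen 0 ≤ N) (s : ℤ) :
    s ∈ (mayaOf la).occ ↔ s < -(N : ℤ) ∨ ∃ i : Fin N, coord la i = s := by
  rw [mayaOf_eq_sea la hN]
  simp

theorem bddAbove_colour (p : ℕ+) (c : Fin p) (la : YoungDiagram) :
    BddAbove {x : ℤ | ((p : ℕ) : ℤ) * x + (c : ℕ) ∈ (mayaOf la).occ} := by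
  refine ⟨max (coord la 0) 0, ?_⟩
  rintro x ⟨i, hi⟩
  have h1 := (coord_strictAnti la).antitone (Nat.zero_le i)
  have hp : (1 : ℤ) ≤ ((p : ℕ) : ℤ) := by exact_mod_cast p.pos
  rw [hi] at h1
  rcases le_or_gt x 0 with hx | hx
  · exact hx.trans (le_max_right _ _)
  · have := mul_le_mul_of_nonneg_right hp hx.le
    exact le_trans (by omega) (le_max_left _ _)

theorem unbounded_colour (p : ℕ+) (c : Fin p) (la : YoungDiagram) (a : ℤ) :
    ∃ x ∈ {x : ℤ | ((p : ℕ) : ℤ) * x + (c : ℕ) ∈ (mayaOf la).occ}, x < a := by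
  have hp : (1 : ℤ) ≤ ((p : ℕ) : ℤ) := by exact_mod_cast p.pos
  have hc : ((c : ℕ) : ℤ) < ((p : ℕ) : ℤ) := by exact_mod_cast c.2
  set x := min (a - 1) (-(la.colLen 0 : ℤ) - 2) with hx
  have hxa : x ≤ a - 1 := min_le_left _ _
  have hxN : x ≤ -(la.colLen 0 : ℤ) - 2 := min_le_right _ _
  refine ⟨x, (mem_mayaOf_iff la le_rfl _).mpr (Or.inl ?_), by omega⟩
  have := mul_le_mul_of_nonpos_right hp (show x + 1 ≤ 0 by omega)
  rw [mul_add] at this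
  omega

theorem colourCoord_strictAnti (p : ℕ+) (c : Fin p) (la : YoungDiagram) :
    StrictAnti (colourCoord p c la) :=
  enumDown_strictAnti (bddAbove_colour p c la) (unbounded_colour p c la)

theorem range_colourCoord (p : ℕ+) (c : Fin p) (la : YoungDiagram) :
    Set.range (colourCoord p c la) = {x | ((p : ℕ) : ℤ) * x + (c : ℕ) ∈ (mayaOf la).occ} :=
  range_enumDown (bddAbove_colour p c la) (unbounded_colour p c la)

/-- The number of particles of colour `c` among the first `N` particles of `λ`. -/
def colourCount (p : ℕ+) (la : YoungDiagram) (N : ℕ) (c : Fin p) : ℕ :=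
  (Finset.univ.filter fun i : Fin N => residue p (coord la i) = c).card

/-- The particles of colour `c` at sites `≥ -N`, i.e. among the first `N` particles of `λ`, are the
first `colourCount p la N c` particles of that colour. -/
theorem neg_le_colourCoord_iff (p : ℕ+) (c : Fin p) (la : YoungDiagram) {N : ℕ}
    (hN : la.colLen 0 ≤ N) (i : ℕ) :
    -(N : ℤ) ≤ ((p : ℕ) : ℤ) * colourCoord p c la i + (c : ℕ) ↔ i < colourCount p la N c := by
  classical
  have hp : (0 : ℤ) < ((p : ℕ) : ℤ) := by exact_mod_cast p.pos
  set f := fun i => ((p : ℕ) : ℤ) * colourCoord p c la i + (c : ℕ) with hf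
  have hanti : StrictAnti f := fun i j hij => by
    have := mul_lt_mul_of_pos_left (colourCoord_strictAnti p c la hij) hp
    simp only [hf]
    omega
  have hmem : ∀ i, f i ∈ (mayaOf la).occ := fun i => by
    have : colourCoord p c la i ∈ Set.range (colourCoord p c la) := ⟨i, rfl⟩
    rwa [range_colourCoord] at this
  have hex : ∃ i, f i < -(N : ℤ) := by
    obtain ⟨x, hx, hlt⟩ := unbounded_colour p c la (-(N : ℤ) - (c : ℕ))
    rw [← range_colourCoord] at hx
    obtain ⟨i, rfl⟩ := hx
    refine ⟨i, ?_⟩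
    have hN0 : (0 : ℤ) ≤ N := Int.natCast_nonneg N
    have : ((p : ℕ) : ℤ) * colourCoord p c la i ≤ 1 * colourCoord p c la i :=
      mul_le_mul_of_nonpos_right (by omega) (by omega)
    simp only [hf]
    omega
  have hiff : ∀ i, -(N : ℤ) ≤ f i ↔ i < Nat.find hex := by
    intro i
    rw [Nat.lt_find_iff]
    constructor
    · intro h j hj
      have := hanti.antitone hj
      exact not_lt.mpr (h.trans this)
    · intro h
      exact not_lt.mp (h i le_rfl)
  have hcard : Nat.find hex = colourCount p la N c := by
    have himg : (Finset.range (Nat.find hex)).image f =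
        (Finset.univ.filter fun i : Fin N => residue p (coord la i) = c).image
          fun i : Fin N => coord la i := by
      ext s
      simp only [Finset.mem_image, Finset.mem_range, Finset.mem_filter, Finset.mem_univ, true_and]
      constructor
      · rintro ⟨i, hi, rfl⟩
        have h1 := (hiff i).mpr hi
        rcases (mem_mayaOf_iff la hN _).mp (hmem i) with h | ⟨j, hj⟩
        · omega
        · exact ⟨j, by rw [hj]; exact residue_mul_add p c _, hj⟩
      · rintro ⟨j, hj, rfl⟩
        have h1 := mul_ediv_add_residue p (coord la j)
        rw [hj] at h1
        have h2 : coord la j / ((p : ℕ) : ℤ) ∈ Set.range (colourCoord p c la) := by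
          rw [range_colourCoord]
          change _ ∈ (mayaOf la).occ
          rw [h1]
          exact ⟨j, rfl⟩
        obtain ⟨i, hi⟩ := h2
        have h3 : f i = coord la j := by simp only [hf, hi, h1]
        exact ⟨i, (hiff i).mp (h3 ▸ neg_le_coord la j.2), h3⟩
    have := congrArg Finset.card himg
    have hinj : Function.Injective fun i : Fin N => coord la i :=
      fun i j h => Fin.ext ((coord_strictAnti la).injective h)
    rw [Finset.card_image_of_injective _ hanti.injective, Finset.card_range,
      Finset.card_image_of_injective _ hinj] at this
    exact this
  rw [← hcard]
  exact hiff i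

/-- Below the first `N` particles of `λ` all sites are occupied, so from then on the particles of
each colour descend in steps of one. -/
theorem colourCoord_add (p : ℕ+) (c : Fin p) (la : YoungDiagram) {N : ℕ} (hN : la.colLen 0 ≤ N)
    (i : ℕ) : colourCoord p c la (colourCount p la N c + i) =
      (-(N : ℤ) - 1 - (c : ℕ)) / ((p : ℕ) : ℤ) - i := by
  have hp : (0 : ℤ) < ((p : ℕ) : ℤ) := by exact_mod_cast p.pos
  have hbelow : ∀ z : ℤ, ((p : ℕ) : ℤ) * z + (c : ℕ) < -(N : ℤ) ↔
      z ≤ (-(N : ℤ) - 1 - (c : ℕ)) / ((p : ℕ) : ℤ) := by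
    intro z
    rw [Int.le_ediv_iff_mul_le hp, mul_comm z]
    omega
  have h1 : enumDown {z : ℤ | ((p : ℕ) : ℤ) * z + (c : ℕ) < -(N : ℤ)} =
      fun i => colourCoord p c la (colourCount p la N c + i) := by
    refine enumDown_eq (fun i j hij => colourCoord_strictAnti p c la (by omega)) ?_
    ext z
    constructor
    · rintro ⟨i, rfl⟩
      by_contra hz
      have h : -(N : ℤ) ≤ _ := not_lt.mp hz
      have := (neg_le_colourCoord_iff p c la hN _).mp h
      omega
    · intro hz
      have hz' : z ∈ Set.range (colourCoord p c la) := by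
        rw [range_colourCoord]
        exact (mem_mayaOf_iff la hN _).mpr (Or.inl hz)
      obtain ⟨j, rfl⟩ := hz'
      have hj : ¬ j < colourCount p la N c := fun h =>
        absurd ((neg_le_colourCoord_iff p c la hN j).mpr h) (not_le.mpr hz)
      exact ⟨j - colourCount p la N c, by simp only; congr 1; omega⟩
  have h2 : enumDown {z : ℤ | ((p : ℕ) : ℤ) * z + (c : ℕ) < -(N : ℤ)} =
      fun i : ℕ => (-(N : ℤ) - 1 - (c : ℕ)) / ((p : ℕ) : ℤ) - i := by
    refine enumDown_eq (fun i j hij => by omega) ?_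
    ext z
    rw [Set.mem_ofPred_eq, hbelow]
    constructor
    · rintro ⟨i, rfl⟩
      simp only
      omega
    · intro hz
      exact ⟨((-(N : ℤ) - 1 - (c : ℕ)) / ((p : ℕ) : ℤ) - z).toNat, by simp only; omega⟩
  exact congrFun (h1.symm.trans h2) i

theorem colourCoord_eq_of_le {p : ℕ+} {c : Fin p} {la mu : YoungDiagram} {N : ℕ}
    (hla : la.colLen 0 ≤ N) (hmu : mu.colLen 0 ≤ N)
    (h : colourCount p mu N c = colourCount p la N c) {i : ℕ} (hi : colourCount p la N c ≤ i) :
    colourCoord p c la i = colourCoord p c mu i := by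
  obtain ⟨j, rfl⟩ := Nat.exists_eq_add_of_le hi
  rw [colourCoord_add p c la hla, ← h, colourCoord_add p c mu hmu]

/-- If the numbers of particles of colour `c` differ, so do the charges. -/
theorem skewSchur_colour_eq_zero {p : ℕ+} {c : Fin p} {la mu : YoungDiagram} {N : ℕ}
    (hla : la.colLen 0 ≤ N) (hmu : mu.colLen 0 ≤ N)
    (h : colourCount p la N c ≠ colourCount p mu N c) (t : ℕ → ℂ) :
    skewSchur t (colourRows p (c : ℕ) la) (colourRows p (c : ℕ) mu) = 0 := by
  rw [skewSchur, dif_neg]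
  rintro ⟨n, hn⟩
  have h1 := hn (n + colourCount p la N c + colourCount p mu N c) (by omega)
  have e1 : n + colourCount p la N c + colourCount p mu N c =
    colourCount p la N c + (n + colourCount p mu N c) := by omega
  have e2 : n + colourCount p la N c + colourCount p mu N c =
    colourCount p mu N c + (n + colourCount p la N c) := by omega
  have h2 := colourCoord_add p c la hla (n + colourCount p mu N c)
  have h3 := colourCoord_add p c mu hmu (n + colourCount p la N c)
  rw [← e1] at h2
  rw [← e2] at h3
  unfold colourCoord at h2 h3
  unfold colourRows at h1
  rw [h2, h3] at h1
  push_cast at h1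
  omega

theorem sign_sort_residue (p : ℕ+) (la : YoungDiagram) (N : ℕ) :
    (((Equiv.Perm.sign (Tuple.sort (residue p ∘ fun i : Fin N => coord la i)) : ℤˣ) : ℤ) : ℂ) =
      (-1) ^ colourInversions p la N := by
  rw [sign_sort]
  congr 1
  refine Finset.card_bij (fun ij _ => ((ij.1 : ℕ), (ij.2 : ℕ))) ?_ ?_ ?_
  · rintro ⟨i, j⟩ h
    simpa [residue_lt_iff] using h
  · rintro ⟨i, j⟩ _ ⟨i', j'⟩ _ h
    simpa [Fin.ext_iff] using h
  · rintro ⟨i, j⟩ h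
    simp only [Finset.mem_filter, Finset.mem_product, Finset.mem_range] at h
    exact ⟨(⟨i, h.1.1⟩, ⟨j, h.1.2⟩), by simpa [residue_lt_iff] using h.2, rfl⟩

/-- The determinant of a kernel that preserves colours is, up to the sign of reordering the
particles by colour, the product of the determinants of the colours. -/
theorem det_coord_eq {p : ℕ+} {K : ℤ → ℤ → ℂ}
    (hK : ∀ x y, residue p x ≠ residue p y → K x y = 0) {la mu : YoungDiagram} {N : ℕ}
    (hla : la.colLen 0 ≤ N) (hmu : mu.colLen 0 ≤ N)
    (h : ∀ c, colourCount p mu N c = colourCount p la N c) :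
    (Matrix.of fun i j : Fin N => K (coord la i) (coord mu j)).det =
      (-1) ^ (colourInversions p la N + colourInversions p mu N) *
        ∏ c : Fin p, (Matrix.of fun i j : Fin (colourCount p la N c) =>
          K (((p : ℕ) : ℤ) * colourCoord p c la i + (c : ℕ))
            (((p : ℕ) : ℤ) * colourCoord p c mu j + (c : ℕ))).det := by
  have hp : (0 : ℤ) < ((p : ℕ) : ℤ) := by exact_mod_cast p.pos
  have hanti : ∀ (nu : YoungDiagram) (c : Fin p) (n : ℕ), StrictAnti fun i : Fin n =>
      ((p : ℕ) : ℤ) * colourCoord p c nu i + (c : ℕ) := by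
    intro nu c n i j hij
    have := mul_lt_mul_of_pos_left (colourCoord_strictAnti p c nu hij) hp
    simp only
    omega
  have hrange : ∀ (nu : YoungDiagram), nu.colLen 0 ≤ N → ∀ (c : Fin p) (z : ℤ),
      z ∈ Set.range (fun i : Fin (colourCount p nu N c) =>
        ((p : ℕ) : ℤ) * colourCoord p c nu i + (c : ℕ)) ↔
      z ∈ Set.range (fun i : Fin N => coord nu i) ∧ residue p z = c := by
    intro nu hnu c z
    constructor
    · rintro ⟨i, rfl⟩
      have h1 : colourCoord p c nu i ∈ Set.range (colourCoord p c nu) := ⟨i, rfl⟩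
      rw [range_colourCoord] at h1
      have h2 := (neg_le_colourCoord_iff p c nu hnu i).mpr i.2
      rcases (mem_mayaOf_iff nu hnu _).mp h1 with h3 | h3
      · omega
      · exact ⟨h3, residue_mul_add p c _⟩
    · rintro ⟨⟨j, rfl⟩, hj⟩
      have h1 := mul_ediv_add_residue p (coord nu j)
      simp only at hj
      rw [hj] at h1
      have h2 : coord nu j / ((p : ℕ) : ℤ) ∈ Set.range (colourCoord p c nu) := by
        rw [range_colourCoord]
        change _ ∈ (mayaOf nu).occ
        rw [h1]
        exact ⟨j, rfl⟩
      obtain ⟨i, hi⟩ := h2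
      rw [← hi] at h1
      exact ⟨⟨i, (neg_le_colourCoord_iff p c nu hnu i).mp (h1 ▸ neg_le_coord nu j.2)⟩, h1⟩
  rw [pow_add, ← sign_sort_residue, ← sign_sort_residue]
  refine det_eq_sign_mul_prod_det hK (fun i j hij => coord_strictAnti la hij)
    (fun i j hij => coord_strictAnti mu hij) (fun c => rfl) h (fun c => hanti la c _)
    (fun c => hanti mu c _) (hrange la hla) fun c z => ?_
  have := hrange mu hmu c z
  rw [h] at this
  exact this

theorem det_coord_eq_zero {p : ℕ+} {K : ℤ → ℤ → ℂ}
    (hK : ∀ x y, residue p x ≠ residue p y → K x y = 0) {la mu : YoungDiagram} {N : ℕ} {c : Fin p}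
    (h : colourCount p la N c ≠ colourCount p mu N c) :
    (Matrix.of fun i j : Fin N => K (coord la i) (coord mu j)).det = 0 :=
  det_eq_zero_of_card_ne (f := fun i : Fin N => residue p (coord la i))
    (g := fun i : Fin N => residue p (coord mu i)) (fun _ _ hij => hK _ _ hij) h

/-! ### Factorization of the matrix elements -/

theorem kernel_eq_zero_of_residue_ne {p : ℕ+} (r : ℤ → ℂ) (t : ℕ → ℂ) {x y : ℤ}
    (h : residue p x ≠ residue p y) : kernel p r t x y = 0 := by
  rw [kernel, if_neg]
  exact fun h' => h (residue_eq_of_dvd h'.1)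

theorem weight_eq_prod_Ioc (p : ℕ+) (c : ℤ) (r : ℤ → ℂ) (y : ℤ) (k : ℕ) :
    weight p r (((p : ℕ) : ℤ) * y + c) k = ∏ m ∈ Finset.Ioc y (y + k), colourFun p c r m := by
  refine Finset.prod_nbij' (fun m => y + m + 1) (fun m => (m - y - 1).toNat) ?_ ?_ ?_ ?_ ?_
  · intro m hm
    rw [Finset.mem_range] at hm
    rw [Finset.mem_Ioc]
    omega
  · intro m hm
    rw [Finset.mem_Ioc] at hm
    rw [Finset.mem_range]
    omega
  · intro m _
    omega
  · intro m hm
    rw [Finset.mem_Ioc] at hm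
    omega
  · intro m _
    rw [colourFun]
    congr 1
    ring

/-- Between sites of colour `c` the kernel is that of the one-component flow of `r^{(c)}`. -/
theorem kernel_mul_add (p : ℕ+) (c : ℤ) (r : ℤ → ℂ) (t : ℕ → ℂ) (x y : ℤ) :
    kernel p r t (((p : ℕ) : ℤ) * x + c) (((p : ℕ) : ℤ) * y + c) =
      complete t (x - y) * ∏ m ∈ Finset.Ioc y x, colourFun p c r m := by
  have hp : (0 : ℤ) < ((p : ℕ) : ℤ) := by exact_mod_cast p.pos
  rcases lt_or_ge x y with hxy | hxy
  · rw [complete_of_neg t (by omega), zero_mul, kernel, if_neg]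
    have := mul_lt_mul_of_pos_left hxy hp
    omega
  · obtain ⟨k, rfl⟩ := Int.exists_add_of_le hxy
    rw [← weight_eq_prod_Ioc, add_sub_cancel_left, ← kernel_add]
    congr 1
    ring

theorem stepContentProd_eq (p : ℕ+) (r : ℤ → ℂ) (la mu : YoungDiagram) :
    stepContentProd p r la mu = ∏ c : Fin p, contentProd (colourFun p (c : ℕ) r)
      (colourRows p (c : ℕ) la) (colourRows p (c : ℕ) mu) := by
  rw [stepContentProd, Finset.prod_range]
  refine Finset.prod_congr rfl fun c _ => finprod_congr fun i => Finset.prod_congr rfl fun j _ => ?_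
  rw [colourFun]
  congr 1
  ring

theorem skewSchur_rows (t : ℕ → ℂ) {la mu : YoungDiagram} {N : ℕ} (hla : la.colLen 0 ≤ N)
    (hmu : mu.colLen 0 ≤ N) : skewSchur t (rows la) (rows mu) =
      (Matrix.of fun i j : Fin N => complete t (coord la i - coord mu j)).det := by
  refine skewSchur_eq_det t (coord_strictAnti mu) (fun i => ?_) (fun i => ?_) fun i hi => ?_
  · simp [rows, coord]
  · simp [rows, coord]
  · rw [coord_of_le la (hla.trans hi), coord_of_le mu (hmu.trans hi)]

/-- The stretched skew Schur function factors over the colours. -/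
theorem skewSchur_stretch (p : ℕ+) (t : ℕ → ℂ) (la mu : YoungDiagram) :
    skewSchur (stretch p t) (rows la) (rows mu) = colourSign p la mu *
      ∏ c : Fin p, skewSchur t (colourRows p (c : ℕ) la) (colourRows p (c : ℕ) mu) := by
  set N := max (la.colLen 0) (mu.colLen 0) with hN
  have hla : la.colLen 0 ≤ N := le_max_left _ _
  have hmu : mu.colLen 0 ≤ N := le_max_right _ _
  have hK : ∀ x y, residue p x ≠ residue p y → complete (stretch p t) (x - y) = 0 :=
    fun x y h => complete_stretch_of_not_dvd p t fun h' => h (residue_eq_of_dvd h')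
  rw [skewSchur_rows _ hla hmu]
  by_cases h : ∀ c, colourCount p mu N c = colourCount p la N c
  · rw [det_coord_eq (K := fun x y => complete (stretch p t) (x - y)) hK hla hmu h, colourSign]
    congr 1
    refine Finset.prod_congr rfl fun c _ => ?_
    rw [skewSchur_eq_det t (colourCoord_strictAnti p c mu) (x := colourCoord p c la)
      (a := colourRows p (c : ℕ) la) (b := colourRows p (c : ℕ) mu)
      (fun i => rfl) (fun i => rfl) fun i hi => colourCoord_eq_of_le hla hmu (h c) hi]
    simp only [add_sub_add_right_eq_sub, ← mul_sub, complete_stretch_mul]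
  · push Not at h
    obtain ⟨c, hc⟩ := h
    rw [det_coord_eq_zero (K := fun x y => complete (stretch p t) (x - y)) hK hc.symm,
      Finset.prod_eq_zero (Finset.mem_univ c) (skewSchur_colour_eq_zero hla hmu hc.symm t),
      mul_zero]

theorem matrixElement_Gam_eq_prod (p : ℕ+) (r : ℤ → ℂ) (t : ℕ → ℂ) (la mu : YoungDiagram) :
    matrixElement (mayaOf la) (Gam p r t) (mayaOf mu) = colourSign p la mu *
      ∏ c : Fin p, (contentProd (colourFun p (c : ℕ) r) (colourRows p (c : ℕ) la)
        (colourRows p (c : ℕ) mu) *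
          skewSchur t (colourRows p (c : ℕ) la) (colourRows p (c : ℕ) mu)) := by
  set N := max (la.colLen 0) (mu.colLen 0) with hN
  have hla : la.colLen 0 ≤ N := le_max_left _ _
  have hmu : mu.colLen 0 ≤ N := le_max_right _ _
  have hK : ∀ x y, residue p x ≠ residue p y → kernel p r t x y = 0 :=
    fun x y h => kernel_eq_zero_of_residue_ne r t h
  rw [matrixElement_Gam p r t hla hmu]
  by_cases h : ∀ c, colourCount p mu N c = colourCount p la N c
  · rw [det_coord_eq hK hla hmu h, colourSign]
    congr 1
    refine Finset.prod_congr rfl fun c _ => ?_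
    rw [contentProd_mul_skewSchur _ t (colourCoord_strictAnti p c la)
      (colourCoord_strictAnti p c mu) (a := colourRows p (c : ℕ) la)
      (b := colourRows p (c : ℕ) mu) (fun i => rfl) (fun i => rfl)
      fun i hi => colourCoord_eq_of_le hla hmu (h c) hi]
    simp only [kernel_mul_add]
  · push Not at h
    obtain ⟨c, hc⟩ := h
    rw [det_coord_eq_zero hK hc.symm, Finset.prod_eq_zero (Finset.mem_univ c)
        (by rw [skewSchur_colour_eq_zero hla hmu hc.symm t, mul_zero]), mul_zero]

theorem stepContentProd_mul_skewSchur (p : ℕ+) (r : ℤ → ℂ) (t : ℕ → ℂ) (la mu : YoungDiagram) :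
    stepContentProd p r la mu * skewSchur (stretch p t) (rows la) (rows mu) =
      colourSign p la mu *
        ∏ c : Fin p, (contentProd (colourFun p (c : ℕ) r) (colourRows p (c : ℕ) la)
          (colourRows p (c : ℕ) mu) *
            skewSchur t (colourRows p (c : ℕ) la) (colourRows p (c : ℕ) mu)) := by
  rw [stepContentProd_eq, skewSchur_stretch, Finset.prod_mul_distrib, mul_left_comm]

end FermionFlow

theorem mainTheorem2 (p : ℕ+) (r : ℤ → ℂ) (t : ℕ → ℂ) :
    (∀ c c' : Fin p, Commute
      (FermionFlow.colourGam p (c : ℕ) (FermionFlow.colourFun p (c : ℕ) r) t)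
      (FermionFlow.colourGam p (c' : ℕ) (FermionFlow.colourFun p (c' : ℕ) r) t)) ∧
    FermionFlow.Gam p r t =
      (List.ofFn fun c : Fin p =>
        FermionFlow.colourGam p (c : ℕ) (FermionFlow.colourFun p (c : ℕ) r) t).prod ∧
    ∀ la mu : YoungDiagram,
      FermionFlow.matrixElement (FermionFlow.mayaOf la) (FermionFlow.Gam p r t)
          (FermionFlow.mayaOf mu) =
        FermionFlow.stepContentProd p r la mu *
          FermionFlow.skewSchur (FermionFlow.stretch p t)
            (FermionFlow.rows la) (FermionFlow.rows mu) ∧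
      FermionFlow.stepContentProd p r la mu *
          FermionFlow.skewSchur (FermionFlow.stretch p t)
            (FermionFlow.rows la) (FermionFlow.rows mu) =
        FermionFlow.colourSign p la mu *
          ∏ c ∈ Finset.range p,
            FermionFlow.contentProd (FermionFlow.colourFun p (c : ℕ) r)
                (FermionFlow.colourRows p (c : ℕ) la) (FermionFlow.colourRows p (c : ℕ) mu) *
              FermionFlow.skewSchur t
                (FermionFlow.colourRows p (c : ℕ) la) (FermionFlow.colourRows p (c : ℕ) mu) := by
  refine ⟨FermionFlow.commute_colourGam p r t, FermionFlow.Gam_eq_prod p r t, fun la mu => ⟨?_, ?_⟩⟩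
  · rw [FermionFlow.matrixElement_Gam_eq_prod, FermionFlow.stepContentProd_mul_skewSchur]
  · rw [FermionFlow.stepContentProd_mul_skewSchur, Finset.prod_range]
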